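/- Let $\eta_0>0$ and let $\Omega=\Omega_{\eta_0}=\{\eta>\eta_0\}\cup S^1\subset\mathbb R^3$ be the open solid torus given in toroidal coordinates $$x=\Big(\frac{\sin\theta}{\cosh\eta-\cos\theta},\ \frac{\sinh\eta\cos\varphi}{\cosh\eta-\cos\theta},\ \frac{\sinh\eta\sin\varphi}{\cosh\eta-\cos\theta}\Big),$$ where $S^1=\{x_0=0,\ x_1^2+x_2^2=1\}$. Let $dS$ be the surface measure of $\partial\Omega$ and $\alpha(\eta_0)$ the area of $\partial\Omega$. Let $H^{1/2}(\partial\Omega)$ be the space of traces of functions in $H^1(\Omega)$, regarded as a subspace of $L^2(\partial\Omega)$, and $H^{-1/2}(\partial\Omega)$ its dual. Let $\Lambda\colon H^{1/2}(\partial\Omega)\to H^{-1/2}(\partial\Omega)$ be the Dirichlet-to-Neumann map: $\Lambda f=h$ if the harmonic $u\in H^1(\Omega)$ with trace $f$ has (weak) normal derivative $h$ with respect to the normal pointing into $\Omega$, i.e. $\int_\Omega\nabla u\cdot\nabla v\,dx=-\langle h,\operatorname{tr}v\rangle$ for all $v\in H^1(\Omega)$. Put $\Phi_n^{+}(\theta)=\cos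 n\theta$, $\Phi_n^{-}(\theta)=\sin n\theta$. A family of real numbers $a_{n,m}^{\nu,\mu}$ ($n,m\ge0$, $\nu,\mu\in\{+,-\}$, excluding the indices with $n=0,\nu=-$ or $m=0,\mu=-$) is called the family of coefficients of $f$ if $$f(\theta,\varphi)=\sqrt{\cosh\eta_0-\cos\theta}\ \sum_{n,m,\nu,\mu}a_{n,m}^{\nu,\mu}\,\Phi_n^\nu(\theta)\,\Phi_m^\mu(\varphi)$$ with unconditional convergence in $L^2(\partial\Omega)$. Let $\varepsilon_0=1$, $\varepsilon_n=2$ for $n\ge1$, and $q_{n,0}=Q_{n-1/2}(\cosh\eta_0)$, where $$Q_k(t)=\frac1{2^{k+1}}\int_{-1}^1\frac{(1-s^2)^k}{(t-s)^{k+1}}\,ds$$ is the Legendre function of the second kind. Let $h\in H^{-1/2}(\partial\Omega)$, let $f\in H^{1/2}(\partial\Omega)$ be a particular solution of $\Lambda f=h$, let $c_1=\int_{\partial\Omega}f\,dS$, and let $c\in\mathbb R$. Then $f$ has an expansion of the above form, and if $a_{n,m}^{\nu,\mu}$ are its coefficients, then replacing $a_{n,0}^{+,+}$ for every $n\ge 0$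 by $$\hat a_{n,0}^{+,+}=a_{n,0}^{+,+}+\varepsilon_n\,\frac{\sqrt2}{\pi}\,\frac{q_{n,0}}{\alpha(\eta_0)}\,(c-c_1)$$ and leaving all other coefficients unchanged gives the coefficients of a function $\hat f\in H^{1/2}(\partial\Omega)$, which satisfies $\Lambda\hat f=h$ and $\int_{\partial\Omega}\hat f\,dS=c$ and is the only element of $H^{1/2}(\partial\Omega)$ with these two properties. -/

import Mathlib

open MeasureTheory Filter Topology Set
open scoped ENNReal ContDiff InnerProductSpace

noncomputable section

namespace Toroidal

/-- Euclidean three-space. -/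
abbrev E3 : Type := EuclideanSpace ℝ (Fin 3)

/-- The point `(x₀, x₁, x₂)` with toroidal coordinates `(η, θ, φ)`. -/
def point (η θ φ : ℝ) : E3 :=
  !₂[Real.sin θ / (Real.cosh η - Real.cos θ),
     Real.sinh η * Real.cos φ / (Real.cosh η - Real.cos θ),
     Real.sinh η * Real.sin φ / (Real.cosh η - Real.cos θ)]

/-- The limiting circle `S¹` (the limit `η → ∞` of the coordinates). -/
def limitCircle : Set E3 := {x | x 0 = 0 ∧ x 1 ^ 2 + x 2 ^ 2 = 1}

/-- The open solid torus `Ω_{η₀} = {η > η₀} ∪ S¹`. -/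
def solidTorus (η₀ : ℝ) : Set E3 :=
  {x | ∃ η θ φ : ℝ, η₀ < η ∧ x = point η θ φ} ∪ limitCircle

/-- Lebesgue measure on the solid torus. -/
abbrev volTorus (η₀ : ℝ) : Measure E3 := volume.restrict (solidTorus η₀)

/-- The area element `|x_θ × x_φ|` of the parametrization `(θ, φ) ↦ point η₀ θ φ` of the boundary,
written as the square root of the Gram determinant of the two tangent vectors. -/
def areaElement (η₀ : ℝ) (p : ℝ × ℝ) : ℝ :=
  Real.sqrt
    (‖deriv (fun θ => point η₀ θ p.2) p.1‖ ^ 2 * ‖deriv (fun φ => point η₀ p.1 φ) p.2‖ ^ 2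
      - ⟪deriv (fun θ => point η₀ θ p.2) p.1, deriv (fun φ => point η₀ p.1 φ) p.2⟫_ℝ ^ 2)

/-- The surface element `dS` in the coordinates `(θ, φ) ∈ (-π, π]²`. -/
def surfaceParam (η₀ : ℝ) : Measure (ℝ × ℝ) :=
  (volume.restrict (Ioc (-Real.pi) Real.pi ×ˢ Ioc (-Real.pi) Real.pi)).withDensity
    (fun p => ENNReal.ofReal (areaElement η₀ p))

/-- The surface measure `dS` of the torus `∂Ω_{η₀}`, as a measure on space. -/
def surfaceMeasure (η₀ : ℝ) : Measure E3 :=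
  (surfaceParam η₀).map (fun p => point η₀ p.1 p.2)

/-- The area `α(η₀)` of `∂Ω_{η₀}`. -/
def area (η₀ : ℝ) : ℝ := (surfaceMeasure η₀).real univ

/-! Sobolev spaces -/

/-- `L²(Ω_{η₀})`. -/
abbrev L2 (η₀ : ℝ) : Type := Lp ℝ 2 (volTorus η₀)

/-- Square integrable vector fields on `Ω_{η₀}`. -/
abbrev L2V (η₀ : ℝ) : Type := Lp E3 2 (volTorus η₀)

/-- `L²(∂Ω_{η₀})`. -/
abbrev L2Bdry (η₀ : ℝ) : Type := Lp ℝ 2 (surfaceMeasure η₀)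

/-- Test functions `C_c^∞(Ω_{η₀})`. -/
def IsTest (η₀ : ℝ) (ψ : E3 → ℝ) : Prop :=
  ContDiff ℝ ∞ ψ ∧ HasCompactSupport ψ ∧ tsupport ψ ⊆ solidTorus η₀

/-- `G` is the distributional gradient of `u` on `Ω_{η₀}`. -/
def IsWeakGrad {η₀ : ℝ} (u : L2 η₀) (G : L2V η₀) : Prop :=
  ∀ ψ : E3 → ℝ, IsTest η₀ ψ → ∀ e : E3,
    ∫ x in solidTorus η₀, u x * fderiv ℝ ψ x e
      = - ∫ x in solidTorus η₀, ⟪e, G x⟫_ℝ * ψ x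

lemma IsTest.memLp {η₀ : ℝ} {ψ : E3 → ℝ} (h : IsTest η₀ ψ) : MemLp ψ 2 (volTorus η₀) :=
  (h.1.continuous.memLp_of_hasCompactSupport h.2.1).restrict _

lemma IsTest.memLp_fderiv {η₀ : ℝ} {ψ : E3 → ℝ} (h : IsTest η₀ ψ) (e : E3) :
    MemLp (fun x => fderiv ℝ ψ x e) 2 (volTorus η₀) := by
  have hc : Continuous (fun x => fderiv ℝ ψ x e) :=
    (h.1.continuous_fderiv (by simp)).clm_apply continuous_const
  exact (hc.memLp_of_hasCompactSupport (h.2.1.fderiv_apply (𝕜 := ℝ) e)).restrict _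

/-- The Sobolev space `H¹(Ω_{η₀})`; an element is stored together with its weak gradient. -/
def H1 (η₀ : ℝ) : Submodule ℝ (L2 η₀ × L2V η₀) where
  carrier := {p | IsWeakGrad p.1 p.2}
  zero_mem' := by
    intro ψ hψ e
    have h1 : ∫ x in solidTorus η₀, (0 : L2 η₀ × L2V η₀).1 x * fderiv ℝ ψ x e = 0 := by
      rw [integral_congr_ae (g := fun _ => (0 : ℝ)), integral_zero]
      filter_upwards [Lp.coeFn_zero ℝ 2 (volTorus η₀)] with x hx
      rw [Prod.fst_zero, hx, Pi.zero_apply, zero_mul]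
    have h2 : ∫ x in solidTorus η₀, ⟪e, (0 : L2 η₀ × L2V η₀).2 x⟫_ℝ * ψ x = 0 := by
      rw [integral_congr_ae (g := fun _ => (0 : ℝ)), integral_zero]
      filter_upwards [Lp.coeFn_zero E3 2 (volTorus η₀)] with x hx
      rw [Prod.snd_zero, hx, Pi.zero_apply, inner_zero_right, zero_mul]
    rw [h1, h2, neg_zero]
  add_mem' := by
    intro p q hp hq ψ hψ e
    have i1 (u : L2 η₀) : Integrable (fun x => u x * fderiv ℝ ψ x e) (volTorus η₀) :=
      (Lp.memLp u).integrable_mul (hψ.memLp_fderiv e)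
    have i2 (G : L2V η₀) : Integrable (fun x => ⟪e, G x⟫_ℝ * ψ x) (volTorus η₀) :=
      ((Lp.memLp G).const_inner e).integrable_mul hψ.memLp
    have h1 : ∫ x in solidTorus η₀, (p + q).1 x * fderiv ℝ ψ x e
        = ∫ x in solidTorus η₀, (p.1 x * fderiv ℝ ψ x e + q.1 x * fderiv ℝ ψ x e) := by
      apply integral_congr_ae
      filter_upwards [Lp.coeFn_add p.1 q.1] with x hx
      rw [Prod.fst_add, hx, Pi.add_apply, add_mul]
    have h2 : ∫ x in solidTorus η₀, ⟪e, (p + q).2 x⟫_ℝ * ψ x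
        = ∫ x in solidTorus η₀, (⟪e, p.2 x⟫_ℝ * ψ x + ⟪e, q.2 x⟫_ℝ * ψ x) := by
      apply integral_congr_ae
      filter_upwards [Lp.coeFn_add p.2 q.2] with x hx
      rw [Prod.snd_add, hx, Pi.add_apply, inner_add_right, add_mul]
    rw [h1, h2, integral_add (i1 _) (i1 _), integral_add (i2 _) (i2 _), hp ψ hψ e, hq ψ hψ e]
    ring
  smul_mem' := by
    intro r p hp ψ hψ e
    have h1 : ∫ x in solidTorus η₀, (r • p).1 x * fderiv ℝ ψ x e
        = ∫ x in solidTorus η₀, r * (p.1 x * fderiv ℝ ψ x e) := by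
      apply integral_congr_ae
      filter_upwards [Lp.coeFn_smul r p.1] with x hx
      rw [Prod.smul_fst, hx, Pi.smul_apply, smul_eq_mul, mul_assoc]
    have h2 : ∫ x in solidTorus η₀, ⟪e, (r • p).2 x⟫_ℝ * ψ x
        = ∫ x in solidTorus η₀, r * (⟪e, p.2 x⟫_ℝ * ψ x) := by
      apply integral_congr_ae
      filter_upwards [Lp.coeFn_smul r p.2] with x hx
      rw [Prod.smul_snd, hx, Pi.smul_apply, inner_smul_right, mul_assoc]
    rw [h1, h2, integral_const_mul, integral_const_mul, hp ψ hψ e]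
    ring

/-- The triples `(w|_Ω, ∇w|_Ω, w|_∂Ω)` for smooth functions `w`. -/
def smoothGraph (η₀ : ℝ) : Submodule ℝ ((L2 η₀ × L2V η₀) × L2Bdry η₀) where
  carrier := {p | ∃ w : E3 → ℝ, ContDiff ℝ ∞ w ∧ p.1.1 =ᵐ[volTorus η₀] w ∧
    p.1.2 =ᵐ[volTorus η₀] gradient w ∧ p.2 =ᵐ[surfaceMeasure η₀] w}
  zero_mem' := by
    refine ⟨fun _ => 0, contDiff_const, Lp.coeFn_zero _ _ _, ?_, Lp.coeFn_zero _ _ _⟩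
    filter_upwards [Lp.coeFn_zero E3 2 (volTorus η₀)] with x hx
    rw [gradient_fun_const]
    exact hx
  add_mem' := by
    rintro p q ⟨w, hw, h1, h2, h3⟩ ⟨z, hz, k1, k2, k3⟩
    refine ⟨fun x => w x + z x, hw.add hz, ?_, ?_, ?_⟩
    · filter_upwards [Lp.coeFn_add p.1.1 q.1.1, h1, k1] with x hx a b
      simp only [Prod.fst_add]
      rw [hx, Pi.add_apply, a, b]
    · filter_upwards [Lp.coeFn_add p.1.2 q.1.2, h2, k2] with x hx a b
      have hg : gradient (fun x => w x + z x) x = gradient w x + gradient z x := by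
        unfold gradient
        rw [fderiv_fun_add (hw.differentiable (by simp) x) (hz.differentiable (by simp) x),
          map_add]
      simp only [Prod.fst_add, Prod.snd_add]
      rw [hx, Pi.add_apply, a, b, hg]
    · filter_upwards [Lp.coeFn_add p.2 q.2, h3, k3] with x hx a b
      simp only [Prod.snd_add]
      rw [hx, Pi.add_apply, a, b]
  smul_mem' := by
    rintro r p ⟨w, hw, h1, h2, h3⟩
    refine ⟨fun x => r * w x, contDiff_const.mul hw, ?_, ?_, ?_⟩
    · filter_upwards [Lp.coeFn_smul r p.1.1, h1] with x hx a
      simp only [Prod.smul_fst]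
      rw [hx, Pi.smul_apply, a, smul_eq_mul]
    · filter_upwards [Lp.coeFn_smul r p.1.2, h2] with x hx a
      have hg : gradient (fun x => r * w x) x = r • gradient w x := by
        unfold gradient
        rw [fderiv_const_mul (hw.differentiable (by simp) x)]
        simp
      simp only [Prod.smul_fst, Prod.smul_snd]
      rw [hx, Pi.smul_apply, a, hg]
    · filter_upwards [Lp.coeFn_smul r p.2, h3] with x hx a
      simp only [Prod.smul_snd]
      rw [hx, Pi.smul_apply, a, smul_eq_mul]

/-- `g = tr u`. The trace operator is the continuous extension to `H¹(Ω_{η₀})` of the restriction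
of smooth functions to the boundary, so its graph is the closure of that of the restriction. -/
def IsTrace {η₀ : ℝ} (u : H1 η₀) (g : L2Bdry η₀) : Prop :=
  ((u : L2 η₀ × L2V η₀), g) ∈ (smoothGraph η₀).topologicalClosure

/-- `H^{1/2}(∂Ω_{η₀})`, the space of boundary values of elements of `H¹(Ω_{η₀})`. -/
def HHalf (η₀ : ℝ) : Submodule ℝ (L2Bdry η₀) where
  carrier := {g | ∃ u : H1 η₀, IsTrace u g}
  zero_mem' := ⟨0, Submodule.zero_mem _⟩
  add_mem' := by
    rintro f g ⟨u, hu⟩ ⟨v, hv⟩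
    exact ⟨u + v, Submodule.add_mem _ hu hv⟩
  smul_mem' := by
    rintro r f ⟨u, hu⟩
    exact ⟨r • u, Submodule.smul_mem _ r hu⟩

/-- `H^{-1/2}(∂Ω_{η₀})`: the linear functionals on `H^{1/2}(∂Ω_{η₀})` that are bounded in its
quotient norm `‖g‖ = inf {‖v‖_{H¹} : tr v = g}`. (The norm of `H1 η₀` used here is the maximum of
the `L²` norms of the function and of its gradient, which is equivalent to the usual one.) -/
structure HMinusHalf (η₀ : ℝ) where
  toFun : HHalf η₀ →ₗ[ℝ] ℝ
  bounded : ∃ C : ℝ, ∀ (v : H1 η₀) (g : HHalf η₀), IsTrace v g → |toFun g| ≤ C * ‖v‖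

/-- `u ∈ H¹(Ω_{η₀})` is (weakly) harmonic. -/
def IsHarmonic {η₀ : ℝ} (u : H1 η₀) : Prop :=
  ∀ ψ : E3 → ℝ, IsTest η₀ ψ → ∫ x in solidTorus η₀, ⟪u.1.2 x, gradient ψ x⟫_ℝ = 0

/-- `h ∈ H^{-1/2}` is the derivative of `u` along the unit normal pointing INTO `Ω_{η₀}`,
in the weak sense: `∫_Ω ∇u · ∇v = -⟨h, tr v⟩` for all `v ∈ H¹(Ω_{η₀})`. -/
def IsNormalDeriv {η₀ : ℝ} (u : H1 η₀) (h : HMinusHalf η₀) : Prop :=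
  ∀ (v : H1 η₀) (g : HHalf η₀), IsTrace v g →
    ∫ x in solidTorus η₀, ⟪u.1.2 x, v.1.2 x⟫_ℝ = - h.toFun g

/-- `Λ f = h` for the Dirichlet-to-Neumann map `Λ` of `Ω_{η₀}`: the harmonic function with
boundary values `f` has normal derivative `h`. -/
def DirichletToNeumann {η₀ : ℝ} (f : HHalf η₀) (h : HMinusHalf η₀) : Prop :=
  ∃ u : H1 η₀, IsHarmonic u ∧ IsTrace u f ∧ IsNormalDeriv u h

/-- `∫_{∂Ω} f dS`. -/
def bdryIntegral {η₀ : ℝ} (f : HHalf η₀) : ℝ := ∫ x, (f : L2Bdry η₀) x ∂(surfaceMeasure η₀)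

/-! Toroidal expansions -/

/-- `Φ_n^ν`: `cos nθ` for `ν = 1`, `sin nθ` for `ν = -1`. -/
def Phi (n : ℕ) (ν : ℤˣ) (θ : ℝ) : ℝ :=
  if ν = 1 then Real.cos (n * θ) else Real.sin (n * θ)

/-- The indices `(n, m, ν, μ)` of the expansions, without those for which
`Φ_n^ν` or `Φ_m^μ` is `Φ_0^- = 0`. -/
structure Index where
  n : ℕ
  m : ℕ
  ν : ℤˣ
  μ : ℤˣ
  hn : ¬ (n = 0 ∧ ν = -1)
  hm : ¬ (m = 0 ∧ μ = -1)

/-- The restriction of the interior toroidal harmonic `I_{n,m}^{ν,μ}` to `∂Ω_{η₀}`. -/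
def bdryHarmonic (η₀ : ℝ) (i : Index) (p : ℝ × ℝ) : ℝ :=
  Real.sqrt (Real.cosh η₀ - Real.cos p.1) * Phi i.n i.ν p.1 * Phi i.m i.μ p.2

/-- `f = ∑ a_{n,m}^{ν,μ} I_{n,m}^{ν,μ}` on `∂Ω_{η₀}`, with (unconditional) convergence
in `L²(∂Ω_{η₀})`. -/
def HasExpansion {η₀ : ℝ} (f : HHalf η₀) (a : Index → ℝ) : Prop :=
  Tendsto (fun s : Finset Index =>
      eLpNorm (fun p : ℝ × ℝ => (f : L2Bdry η₀) (point η₀ p.1 p.2)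
        - ∑ i ∈ s, a i * bdryHarmonic η₀ i p) 2 (surfaceParam η₀))
    atTop (𝓝 0)

/-- The associated Legendre function `Q_k^m(t)` of the second kind, for real degree `k > -1`,
integer order `m ≥ 0` and `t > 1`. -/
def legendreQ (k : ℝ) (m : ℕ) (t : ℝ) : ℝ :=
  (-1) ^ m / 2 ^ (k + 1) * (Real.Gamma (k + m + 1) / Real.Gamma (k + 1))
    * (t ^ 2 - 1) ^ ((m : ℝ) / 2)
    * ∫ s in (-1 : ℝ)..1, (1 - s ^ 2) ^ k / (t - s) ^ (k + m + 1)

/-- `q_{n,m} = Q_{n-1/2}^m(cosh η₀)`. -/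
def q (η₀ : ℝ) (n m : ℕ) : ℝ := legendreQ ((n : ℝ) - 1 / 2) m (Real.cosh η₀)

/-- The Neumann factor `ε_0 = 1`, `ε_n = 2` for `n ≥ 1`. -/
def neumannFactor (n : ℕ) : ℝ := if n = 0 then 1 else 2

/-- The coefficients `a` with `a_{n,0}^{+,+}` increased by `ε_n (√2/π) q_{n,0} d / α(η₀)`
for every `n`, and all others unchanged. -/
def shiftCoeffs (η₀ d : ℝ) (a : Index → ℝ) (i : Index) : ℝ :=
  if i.m = 0 ∧ i.ν = 1 ∧ i.μ = 1 then
    a i + neumannFactor i.n * (Real.sqrt 2 / Real.pi) * (q η₀ i.n 0 / area η₀) * d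
  else a i

end Toroidal

end

/-!
The set of solutions of `Λ f = h` is a coset of the constants, and the theorem is the computation of
the constant and of its toroidal coefficients.

*Constants are in the kernel of `Λ`*, because the constant function has zero gradient
(`constH1`, `DirichletToNeumann.add_const`). Hence `f + (c - c₁) / α(η₀)` is a solution with boundary
integral `c`. By Heine's formula
`(cosh η₀ - cos θ)^(-1/2) = (√2 / π) ∑ εₙ Q_{n-1/2}(cosh η₀) cos nθ`
its coefficients are the shifted ones (`hasExpansion_const`). The formula is obtained by showing
that the Fourier integral and the integral defining `Q_{n-1/2}`, taken in the variable
`s = cos θ`, satisfy the same three-term recurrence in `n` and agree for `n = 0, 1`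
(`heineCos_eq_q`).

*The kernel consists of constants.* The difference of two solutions is the trace of a function with
zero Dirichlet energy, so it is a limit in `L²(∂Ω)` of smooth functions `w` whose gradients tend to
zero in `L²(Ω)`. For smooth `w` the double integral of `|w(p) - w(p')|` over pairs of boundary points
is at most a constant times `∫_Ω |∇w|`: two boundary points are joined by paths through the shell
`η₀ < η ≤ η₀ + 1` along the coordinate lines, and the bound for one path is averaged over its depth
(`lintegral_oscillation_le`, `exists_lintegral_shell_le`). The limit is therefore constant
(`exists_ae_eq_const_of_isTrace`). Neither a trace inequality nor the connectedness of `Ω` is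
needed separately. A constant with boundary integral zero vanishes, as the area is positive.

*Expansions exist* because `f(θ, φ) (cosh η₀ - cos θ)^(-1/2)` is square integrable over the parameter
square, where the products of trigonometric functions form a complete orthogonal system
(`ae_eq_zero_of_integral_mul_PhiPhi`, `tendsto_fourier_series`).
-/

namespace Toroidal

/-! ### Completeness of the trigonometric system on the square -/

/-- Lebesgue measure on the period interval `(-π, π]`. -/
noncomputable abbrev periodMeasure : Measure ℝ := volume.restrict (Ioc (-Real.pi) Real.pi)

/-- The square of the `L²(-π, π)` norm of `Φ_n^ν`. -/
noncomputable def phiNormSq (n : ℕ) : ℝ := if n = 0 then 2 * Real.pi else Real.pi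

lemma phiNormSq_pos (n : ℕ) : 0 < phiNormSq n := by
  unfold phiNormSq; split_ifs <;> positivity

lemma Phi_one (n : ℕ) (x : ℝ) : Phi n 1 x = Real.cos (n * x) := by simp [Phi]

lemma Phi_neg_one (n : ℕ) (x : ℝ) : Phi n (-1) x = Real.sin (n * x) := by
  simp [Phi]

lemma continuous_Phi (n : ℕ) (ν : ℤˣ) : Continuous (Phi n ν) := by
  rcases Int.units_eq_one_or ν with rfl | rfl
  · simp only [funext (Phi_one n)]; fun_prop
  · simp only [funext (Phi_neg_one n)]; fun_prop

lemma abs_Phi_le (n : ℕ) (ν : ℤˣ) (x : ℝ) : |Phi n ν x| ≤ 1 := by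
  unfold Phi; split_ifs
  · exact Real.abs_cos_le_one _
  · exact Real.abs_sin_le_one _

lemma integral_periodMeasure (f : ℝ → ℝ) :
    ∫ x, f x ∂periodMeasure = ∫ x in (-Real.pi)..Real.pi, f x :=
  (intervalIntegral.integral_of_le (by linarith [Real.pi_pos])).symm

lemma integral_cos_int_mul (z : ℤ) :
    ∫ x in (-Real.pi)..Real.pi, Real.cos (z * x) = if z = 0 then 2 * Real.pi else 0 := by
  split_ifs with h
  · subst h; simp; ring
  · have hz : (z : ℝ) ≠ 0 := by exact_mod_cast h
    rw [intervalIntegral.integral_comp_mul_left (fun x => Real.cos x) hz, integral_cos]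
    simp [Real.sin_int_mul_pi]

lemma integral_sin_int_mul (z : ℤ) :
    ∫ x in (-Real.pi)..Real.pi, Real.sin (z * x) = 0 := by
  by_cases h : z = 0
  · subst h; simp
  · have hz : (z : ℝ) ≠ 0 := by exact_mod_cast h
    rw [intervalIntegral.integral_comp_mul_left (fun x => Real.sin x) hz, integral_sin]
    simp

/-- Orthogonality of the functions `Φ_n^ν` on a period. -/
lemma integral_Phi_mul_Phi {n : ℕ} {ν : ℤˣ} (hn : ¬ (n = 0 ∧ ν = -1)) (k : ℕ) (κ : ℤˣ) :
    ∫ x, Phi n ν x * Phi k κ x ∂periodMeasure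
      = if n = k ∧ ν = κ then phiNormSq n else 0 := by
  rw [integral_periodMeasure]
  have hc (z : ℤ) (c : ℝ) : IntervalIntegrable (fun x => c * Real.cos (z * x)) volume
      (-Real.pi) Real.pi := Continuous.intervalIntegrable (by fun_prop) _ _
  have hs (z : ℤ) (c : ℝ) : IntervalIntegrable (fun x => c * Real.sin (z * x)) volume
      (-Real.pi) Real.pi := Continuous.intervalIntegrable (by fun_prop) _ _
  rcases Int.units_eq_one_or ν with rfl | rfl <;> rcases Int.units_eq_one_or κ with rfl | rfl
  · have e (x : ℝ) : Phi n 1 x * Phi k 1 x = 1 / 2 * Real.cos (((n - k : ℤ) : ℝ) * x)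
        + 1 / 2 * Real.cos (((n + k : ℤ) : ℝ) * x) := by
      simp only [Phi_one]; push_cast
      rw [sub_mul, add_mul, Real.cos_sub, Real.cos_add]; ring
    simp only [e]
    rw [intervalIntegral.integral_add (hc _ _) (hc _ _), intervalIntegral.integral_const_mul,
      intervalIntegral.integral_const_mul, integral_cos_int_mul, integral_cos_int_mul]
    unfold phiNormSq
    by_cases h1 : n = k
    · subst h1
      by_cases h2 : n = 0
      · simp [h2]; ring
      · have : ¬ ((n : ℤ) + n = 0) := by omega
        simp [h2, this]
    · have h2 : ¬ ((n : ℤ) - k = 0) := by omega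
      have h3 : ¬ ((n : ℤ) + k = 0) := by omega
      simp [h1, h2, h3]
  · have e (x : ℝ) : Phi n 1 x * Phi k (-1) x = 1 / 2 * Real.sin (((n + k : ℤ) : ℝ) * x)
        + (-1 / 2) * Real.sin (((n - k : ℤ) : ℝ) * x) := by
      simp only [Phi_one, Phi_neg_one]; push_cast
      rw [sub_mul, add_mul, Real.sin_sub, Real.sin_add]; ring
    simp only [e]
    rw [intervalIntegral.integral_add (hs _ _) (hs _ _), intervalIntegral.integral_const_mul,
      intervalIntegral.integral_const_mul, integral_sin_int_mul, integral_sin_int_mul]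
    have : (1 : ℤˣ) ≠ -1 := by decide
    simp [this]
  · have e (x : ℝ) : Phi n (-1) x * Phi k 1 x = 1 / 2 * Real.sin (((n + k : ℤ) : ℝ) * x)
        + (1 / 2) * Real.sin (((n - k : ℤ) : ℝ) * x) := by
      simp only [Phi_one, Phi_neg_one]; push_cast
      rw [sub_mul, add_mul, Real.sin_sub, Real.sin_add]; ring
    simp only [e]
    rw [intervalIntegral.integral_add (hs _ _) (hs _ _), intervalIntegral.integral_const_mul,
      intervalIntegral.integral_const_mul, integral_sin_int_mul, integral_sin_int_mul]
    have : (-1 : ℤˣ) ≠ 1 := by decide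
    simp [this]
  · have e (x : ℝ) : Phi n (-1) x * Phi k (-1) x = 1 / 2 * Real.cos (((n - k : ℤ) : ℝ) * x)
        + (-1 / 2) * Real.cos (((n + k : ℤ) : ℝ) * x) := by
      simp only [Phi_neg_one]; push_cast
      rw [sub_mul, add_mul, Real.cos_sub, Real.cos_add]; ring
    simp only [e]
    rw [intervalIntegral.integral_add (hc _ _) (hc _ _), intervalIntegral.integral_const_mul,
      intervalIntegral.integral_const_mul, integral_cos_int_mul, integral_cos_int_mul]
    unfold phiNormSq
    have h0 : n ≠ 0 := fun h => hn ⟨h, rfl⟩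
    have h3 : ¬ ((n : ℤ) + k = 0) := by omega
    by_cases h1 : n = k
    · subst h1
      simp [h0]
    · have h2 : ¬ ((n : ℤ) - k = 0) := by omega
      simp [h1, h2, h3]

lemma integrable_mul_Phi {g : ℝ → ℝ} (hg : MemLp g 2 periodMeasure) (n : ℕ) (ν : ℤˣ) :
    Integrable (fun x => g x * Phi n ν x) periodMeasure :=
  (hg.integrable (by norm_num)).mul_bdd (c := 1) (continuous_Phi n ν).aestronglyMeasurable
    (ae_of_all _ fun x => abs_Phi_le n ν x)

/-- Completeness of the trigonometric system in one variable, from Parseval's identity. -/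
lemma ae_eq_zero_of_integral_mul_Phi {g : ℝ → ℝ} (hg : MemLp g 2 periodMeasure)
    (h : ∀ n ν, ∫ x, g x * Phi n ν x ∂periodMeasure = 0) : g =ᵐ[periodMeasure] 0 := by
  have hab : -Real.pi < Real.pi := by linarith [Real.pi_pos]
  have hgC : MemLp (fun x => (g x : ℂ)) 2 periodMeasure := hg.ofReal
  have hcast (z : ℤ) : (z : ℝ) = z.natAbs ∨ (z : ℝ) = -z.natAbs := by
    rcases Int.natAbs_eq z with hz | hz
    · exact Or.inl ((congrArg (Int.cast : ℤ → ℝ) hz).trans (Int.cast_natCast _))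
    · refine Or.inr ((congrArg (Int.cast : ℤ → ℝ) hz).trans ?_)
      rw [Int.cast_neg, Int.cast_natCast]
  have hco (z : ℤ) : ∫ x, g x * Real.cos (z * x) ∂periodMeasure = 0 := by
    rw [← h z.natAbs 1]
    congr 1; ext x; rw [Phi_one]
    rcases hcast z with hz | hz <;> rw [hz]
    rw [neg_mul, Real.cos_neg]
  have hsi (z : ℤ) : ∫ x, g x * Real.sin (z * x) ∂periodMeasure = 0 := by
    have hn := h z.natAbs (-1)
    simp only [Phi_neg_one] at hn
    rcases hcast z with hz | hz <;> rw [hz]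
    · exact hn
    · simp only [neg_mul, Real.sin_neg, mul_neg, integral_neg, hn, neg_zero]
  have hic (z : ℤ) : Integrable (fun x => g x * Real.cos (z * x)) periodMeasure :=
    (hg.integrable (by norm_num)).mul_bdd (c := 1)
      (Continuous.aestronglyMeasurable (by fun_prop)) (ae_of_all _ fun x => Real.abs_cos_le_one _)
  have his (z : ℤ) : Integrable (fun x => g x * Real.sin (z * x)) periodMeasure :=
    (hg.integrable (by norm_num)).mul_bdd (c := 1)
      (Continuous.aestronglyMeasurable (by fun_prop)) (ae_of_all _ fun x => Real.abs_sin_le_one _)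
  have hcoef (z : ℤ) : fourierCoeffOn hab (fun x => (g x : ℂ)) z = 0 := by
    rw [fourierCoeffOn_eq_integral, intervalIntegral.integral_of_le hab.le]
    have e (x : ℝ) : (fourier (-z) : C(AddCircle (Real.pi - -Real.pi), ℂ)) (x : AddCircle _)
          • (g x : ℂ) = ((g x * Real.cos ((-z : ℤ) * x) : ℝ) : ℂ)
            + ((g x * Real.sin ((-z : ℤ) * x) : ℝ) : ℂ) * Complex.I := by
      rw [fourier_coe_apply]
      have hpi : (Real.pi : ℂ) ≠ 0 := by exact_mod_cast Real.pi_ne_zero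
      have : 2 * (Real.pi : ℂ) * Complex.I * ((-z : ℤ) : ℂ) * x / ((Real.pi - -Real.pi : ℝ) : ℂ)
          = (((-z : ℤ) * x : ℝ) : ℂ) * Complex.I := by
        push_cast; field_simp; ring
      rw [this, Complex.exp_mul_I, ← Complex.ofReal_cos, ← Complex.ofReal_sin]
      simp only [smul_eq_mul, Complex.ofReal_mul]; ring
    simp only [e]
    rw [integral_add (hic (-z)).ofReal ((his (-z)).ofReal.mul_const _), integral_mul_const,
      integral_complex_ofReal, integral_complex_ofReal, hco, hsi]
    simp
  have hP := hasSum_sq_fourierCoeffOn hab hgC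
  simp only [hcoef, norm_zero, ne_eq, OfNat.ofNat_ne_zero, not_false_eq_true, zero_pow] at hP
  have h0 := hP.unique hasSum_zero
  rw [smul_eq_zero, intervalIntegral.integral_of_le hab.le] at h0
  have h0' : ∫ x, ‖(g x : ℂ)‖ ^ 2 ∂periodMeasure = 0 := by
    rcases h0 with h0 | h0
    · exact absurd h0 (inv_ne_zero (by linarith [Real.pi_pos]))
    · exact h0
  rw [integral_eq_zero_iff_of_nonneg (fun x => by positivity) hgC.integrable_norm_pow'] at h0'
  filter_upwards [h0'] with x hx
  simpa using hx

/-- Lebesgue measure on the parameter square `(-π, π]²`. -/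
noncomputable abbrev squareMeasure : Measure (ℝ × ℝ) := periodMeasure.prod periodMeasure

/-- The products `Φ_n^ν(θ) Φ_m^μ(φ)`. -/
noncomputable def PhiPhi (i : Index) (p : ℝ × ℝ) : ℝ := Phi i.n i.ν p.1 * Phi i.m i.μ p.2

/-- The square of the `L²` norm of `PhiPhi i`. -/
noncomputable def phiPhiNormSq (i : Index) : ℝ := phiNormSq i.n * phiNormSq i.m

lemma phiPhiNormSq_pos (i : Index) : 0 < phiPhiNormSq i :=
  mul_pos (phiNormSq_pos _) (phiNormSq_pos _)

lemma continuous_PhiPhi (i : Index) : Continuous (PhiPhi i) :=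
  ((continuous_Phi _ _).comp continuous_fst).mul ((continuous_Phi _ _).comp continuous_snd)

lemma abs_PhiPhi_le (i : Index) (p : ℝ × ℝ) : |PhiPhi i p| ≤ 1 := by
  rw [PhiPhi, abs_mul]
  exact mul_le_one₀ (abs_Phi_le _ _ _) (abs_nonneg _) (abs_Phi_le _ _ _)

lemma memLp_PhiPhi (i : Index) : MemLp (PhiPhi i) 2 squareMeasure :=
  MemLp.of_bound (continuous_PhiPhi i).aestronglyMeasurable 1
    (ae_of_all _ fun p => abs_PhiPhi_le i p)

lemma integral_PhiPhi_mul_PhiPhi (i j : Index) [Decidable (i = j)] :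
    ∫ p, PhiPhi i p * PhiPhi j p ∂squareMeasure = if i = j then phiPhiNormSq i else 0 := by
  have e (p : ℝ × ℝ) : PhiPhi i p * PhiPhi j p
      = (Phi i.n i.ν p.1 * Phi j.n j.ν p.1) * (Phi i.m i.μ p.2 * Phi j.m j.μ p.2) := by
    unfold PhiPhi; ring
  simp only [e]
  rw [integral_prod_mul (fun x => Phi i.n i.ν x * Phi j.n j.ν x)
    (fun x => Phi i.m i.μ x * Phi j.m j.μ x), integral_Phi_mul_Phi i.hn, integral_Phi_mul_Phi i.hm]
  obtain ⟨n, m, ν, μ, h1, h2⟩ := i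
  obtain ⟨n', m', ν', μ', h1', h2'⟩ := j
  simp only [Index.mk.injEq, phiPhiNormSq]
  split_ifs <;> grind

/-- Completeness of the system `Φ_n^ν(θ) Φ_m^μ(φ)`, by Fubini's theorem from completeness in one
variable: the moments `∫ g(θ, φ) Φ_n^ν(θ) dθ` are square integrable functions of `φ` orthogonal
to all `Φ_m^μ`. -/
lemma ae_eq_zero_of_integral_mul_PhiPhi {g : ℝ × ℝ → ℝ} (hg : MemLp g 2 squareMeasure)
    (h : ∀ i, ∫ p, g p * PhiPhi i p ∂squareMeasure = 0) : g =ᵐ[squareMeasure] 0 := by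
  have h' (n m : ℕ) (ν μ : ℤˣ) :
      ∫ p, g p * (Phi n ν p.1 * Phi m μ p.2) ∂squareMeasure = 0 := by
    by_cases hn : n = 0 ∧ ν = -1
    · simp [hn.1, hn.2, Phi_neg_one]
    by_cases hm : m = 0 ∧ μ = -1
    · simp [hm.1, hm.2, Phi_neg_one]
    exact h ⟨n, m, ν, μ, hn, hm⟩
  have hgi : Integrable g squareMeasure := hg.integrable (by norm_num)
  have hsq : Integrable (fun p => g p ^ 2) squareMeasure := hg.integrable_sq
  have hslice : ∀ᵐ y ∂periodMeasure, MemLp (fun x => g (x, y)) 2 periodMeasure := by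
    filter_upwards [hsq.prod_left_ae, hgi.prod_left_ae] with y h1 h2
    exact (memLp_two_iff_integrable_sq h2.aestronglyMeasurable).2 h1
  have hmom (n : ℕ) (ν : ℤˣ) :
      ∀ᵐ y ∂periodMeasure, ∫ x, g (x, y) * Phi n ν x ∂periodMeasure = 0 := by
    have hgPhi : Integrable (fun p : ℝ × ℝ => g p * Phi n ν p.1) squareMeasure :=
      hgi.mul_bdd (c := 1) ((continuous_Phi n ν).comp continuous_fst).aestronglyMeasurable
        (ae_of_all _ fun p => abs_Phi_le n ν p.1)
    have hL2 : MemLp (fun y => ∫ x, g (x, y) * Phi n ν x ∂periodMeasure) 2 periodMeasure := by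
      have hm := hgPhi.integral_prod_right.aestronglyMeasurable
      rw [memLp_two_iff_integrable_sq hm]
      refine Integrable.mono' (hsq.integral_prod_right.const_mul (2 * Real.pi)) (hm.pow 2) ?_
      filter_upwards [hslice] with y hy
      rw [Real.norm_eq_abs, abs_of_nonneg (sq_nonneg _)]
      -- The Cauchy–Schwarz inequality, as nonnegativity of `∫ (g - c Φ)²` for the right `c`.
      set A := ∫ x, g (x, y) * Phi n ν x ∂periodMeasure
      have hpp := Real.pi_pos
      have i1 : Integrable (fun x => g (x, y) ^ 2) periodMeasure := hy.integrable_sq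
      have i2 := (integrable_mul_Phi hy n ν).const_mul (2 * (A / (2 * Real.pi)))
      have i3 : Integrable (fun _ : ℝ => (A / (2 * Real.pi)) ^ 2) periodMeasure :=
        integrable_const _
      have key : 0 ≤ ∫ x, (g (x, y) ^ 2 - 2 * (A / (2 * Real.pi)) * (g (x, y) * Phi n ν x)
          + (A / (2 * Real.pi)) ^ 2) ∂periodMeasure := by
        refine integral_nonneg fun x => ?_
        have := abs_le.1 (abs_Phi_le n ν x)
        have h2 : Phi n ν x ^ 2 ≤ 1 := by nlinarith
        have h3 := mul_le_mul_of_nonneg_left h2 (sq_nonneg (A / (2 * Real.pi)))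
        show 0 ≤ _
        nlinarith [sq_nonneg (g (x, y) - A / (2 * Real.pi) * Phi n ν x)]
      rw [integral_add (i1.sub i2 : Integrable (fun x => _ - _) _) i3, integral_sub i1 i2, integral_const_mul, integral_const] at key
      have hv : periodMeasure.real univ = 2 * Real.pi := by
        simp only [measureReal_restrict_apply_univ, Real.volume_real_Ioc]
        rw [max_eq_left (by linarith)]; ring
      rw [hv, smul_eq_mul] at key
      have e : 2 * (A / (2 * Real.pi)) * A = 2 * (A ^ 2 / (2 * Real.pi)) := by ring
      have e2 : 2 * Real.pi * (A / (2 * Real.pi)) ^ 2 = A ^ 2 / (2 * Real.pi) := by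
        field_simp
      change 0 ≤ _ - 2 * (A / (2 * Real.pi)) * A + _ at key
      rw [e, e2] at key
      have : A ^ 2 / (2 * Real.pi) ≤ ∫ x, g (x, y) ^ 2 ∂periodMeasure := by linarith
      rw [div_le_iff₀ (by positivity)] at this
      linarith
    refine ae_eq_zero_of_integral_mul_Phi hL2 fun m μ => ?_
    rw [← h' n m ν μ]
    have hint : Integrable (fun p : ℝ × ℝ => g p * (Phi n ν p.1 * Phi m μ p.2)) squareMeasure := by
      have := hgPhi.mul_bdd (c := 1) (g := fun p : ℝ × ℝ => Phi m μ p.2)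
        ((continuous_Phi m μ).comp continuous_snd).aestronglyMeasurable
        (ae_of_all _ fun p => abs_Phi_le m μ p.2)
      simpa only [mul_assoc] using this
    rw [integral_prod_symm _ hint]
    congr 1; ext y
    rw [← integral_mul_const]
    simp only [mul_assoc]
  have hall : ∀ᵐ y ∂periodMeasure, (fun x => g (x, y)) =ᵐ[periodMeasure] 0 := by
    have : ∀ᵐ y ∂periodMeasure, ∀ n : ℕ, ∀ ν : ℤˣ,
        ∫ x, g (x, y) * Phi n ν x ∂periodMeasure = 0 :=
      ae_all_iff.2 fun n => ae_all_iff.2 fun ν => hmom n ν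
    filter_upwards [this, hslice] with y h1 h2
    exact ae_eq_zero_of_integral_mul_Phi h2 h1
  have hz : ∫ p, g p ^ 2 ∂squareMeasure = 0 := by
    rw [integral_prod_symm _ hsq, integral_eq_zero_of_ae]
    filter_upwards [hall] with y hy
    refine integral_eq_zero_of_ae ?_
    filter_upwards [hy] with x hx
    simp only [Pi.zero_apply] at hx ⊢
    simp [hx]
  rw [integral_eq_zero_iff_of_nonneg (fun x => sq_nonneg _) hsq] at hz
  filter_upwards [hz] with p hp
  simpa using hp

/-- Every square integrable function on the parameter square is the sum of its Fourier series,
unconditionally in `L²`. -/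
lemma tendsto_fourier_series {g : ℝ × ℝ → ℝ} (hg : MemLp g 2 squareMeasure) :
    Tendsto (fun s : Finset Index => eLpNorm (fun p => g p
        - ∑ i ∈ s, (∫ p, g p * PhiPhi i p ∂squareMeasure) / phiPhiNormSq i * PhiPhi i p)
        2 squareMeasure) atTop (𝓝 0) := by
  classical
  let r (i : Index) : ℝ := (Real.sqrt (phiPhiNormSq i))⁻¹
  have hr (i : Index) : r i * r i = (phiPhiNormSq i)⁻¹ := by
    rw [← mul_inv, Real.mul_self_sqrt (phiPhiNormSq_pos i).le]
  have hm (i : Index) : MemLp (fun p => r i * PhiPhi i p) 2 squareMeasure :=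
    (memLp_PhiPhi i).const_mul (r i)
  let e (i : Index) : Lp ℝ 2 squareMeasure := (hm i).toLp
  have he (i : Index) : e i =ᵐ[squareMeasure] fun p => r i * PhiPhi i p := (hm i).coeFn_toLp
  have hinner (i : Index) (G : Lp ℝ 2 squareMeasure) :
      ⟪e i, G⟫_ℝ = r i * ∫ p, G p * PhiPhi i p ∂squareMeasure := by
    rw [L2.inner_def, ← integral_const_mul]
    refine integral_congr_ae ?_
    filter_upwards [he i] with p hp
    rw [hp]; simp only [RCLike.inner_apply, conj_trivial]; ring
  have hon : Orthonormal ℝ e := by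
    rw [orthonormal_iff_ite]
    intro i j
    rw [hinner]
    have : ∫ p, e j p * PhiPhi i p ∂squareMeasure
        = r j * ∫ p, PhiPhi i p * PhiPhi j p ∂squareMeasure := by
      rw [← integral_const_mul]
      refine integral_congr_ae ?_
      filter_upwards [he j] with p hp
      rw [hp]; ring
    rw [this, integral_PhiPhi_mul_PhiPhi]
    split_ifs with hij
    · subst hij
      rw [← mul_assoc, hr, inv_mul_cancel₀ (phiPhiNormSq_pos i).ne']
    · simp
  have hbot : (Submodule.span ℝ (Set.range e))ᗮ = ⊥ := by
    rw [Submodule.eq_bot_iff]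
    intro G hG
    have h0 (i : Index) : ∫ p, G p * PhiPhi i p ∂squareMeasure = 0 := by
      have h1 := Submodule.inner_right_of_mem_orthogonal
        (Submodule.subset_span (Set.mem_range_self i)) hG
      rw [hinner] at h1
      have : r i ≠ 0 := inv_ne_zero (Real.sqrt_pos.2 (phiPhiNormSq_pos i)).ne'
      simpa [this] using h1
    have := ae_eq_zero_of_integral_mul_PhiPhi (Lp.memLp G) h0
    exact (Lp.eq_zero_iff_ae_eq_zero).2 this
  let b := HilbertBasis.mkOfOrthogonalEqBot hon hbot
  have hb (i : Index) : b i = e i := by simp [b]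
  have hsum := b.hasSum_repr hg.toLp
  simp only [HasSum, SummationFilter.unconditional_filter] at hsum
  rw [Lp.tendsto_Lp_iff_tendsto_eLpNorm'] at hsum
  refine hsum.congr fun s => ?_
  rw [← eLpNorm_neg]
  refine eLpNorm_congr_ae ?_
  have hfin : ∀ᵐ p ∂squareMeasure, ∀ i ∈ s, (((b.repr hg.toLp) i • b i : Lp ℝ 2 squareMeasure) :
      ℝ × ℝ → ℝ) p
      = (∫ p, g p * PhiPhi i p ∂squareMeasure) / phiPhiNormSq i * PhiPhi i p := by
    rw [Finset.eventually_all]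
    intro i _
    filter_upwards [Lp.coeFn_smul ((b.repr hg.toLp) i) (b i), he i] with p h1 h2
    rw [h1, Pi.smul_apply, hb, h2, HilbertBasis.repr_apply_apply, hb, hinner]
    have : ∫ p, (hg.toLp g) p * PhiPhi i p ∂squareMeasure = ∫ p, g p * PhiPhi i p ∂squareMeasure := by
      refine integral_congr_ae ?_
      filter_upwards [hg.coeFn_toLp] with p hp
      rw [hp]
    rw [this, smul_eq_mul, div_eq_mul_inv, ← hr]; ring
  filter_upwards [hfin, hg.coeFn_toLp,
    Lp.coeFn_finsetSum s (fun i => (b.repr hg.toLp) i • b i)] with p h1 h2 h3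
  simp only [Pi.neg_apply, Pi.sub_apply]
  rw [h2, h3, Finset.sum_apply, Finset.sum_congr rfl h1]
  ring

/-! ### Heine's formula -/

section Heine

/-- The integrals `∫₀^π cos(nθ) (t - cos θ)^(-1/2) dθ`. -/
noncomputable def heineCos (t : ℝ) (n : ℕ) : ℝ :=
  ∫ x in (0 : ℝ)..Real.pi, Real.cos (n * x) / Real.sqrt (t - Real.cos x)

/-- The integrals `∫₀^π (sin θ)^(2n) (t - cos θ)^(-n-1/2) dθ`, normalized by `2⁻ⁿ`. -/
noncomputable def heineSin (t : ℝ) (n : ℕ) : ℝ :=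
  ∫ x in (0 : ℝ)..Real.pi, Real.sin x ^ (2 * n)
    / (2 ^ n * (t - Real.cos x) ^ n * Real.sqrt (t - Real.cos x))

variable {t : ℝ}

lemma sub_cos_pos (ht : 1 < t) (x : ℝ) : 0 < t - Real.cos x := by
  linarith [Real.cos_le_one x]

lemma hasDerivAt_sqrt_sub_cos (ht : 1 < t) (x : ℝ) :
    HasDerivAt (fun x => Real.sqrt (t - Real.cos x))
      (Real.sin x / (2 * Real.sqrt (t - Real.cos x))) x := by
  have h1 : HasDerivAt (fun x => t - Real.cos x) (Real.sin x) x := by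
    simpa using (Real.hasDerivAt_cos x).const_sub t
  exact h1.sqrt (sub_cos_pos ht x).ne'

lemma continuous_heineCos_integrand (ht : 1 < t) (n : ℕ) :
    Continuous fun x => Real.cos (n * x) / Real.sqrt (t - Real.cos x) := by
  refine Continuous.div (by fun_prop) (by fun_prop) fun x => ?_
  exact (Real.sqrt_pos.2 (sub_cos_pos ht x)).ne'

lemma heineSin_denom_pos (ht : 1 < t) (n : ℕ) (x : ℝ) :
    0 < 2 ^ n * (t - Real.cos x) ^ n * Real.sqrt (t - Real.cos x) := by
  have := sub_cos_pos ht x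
  have := Real.sqrt_pos.2 this
  positivity

lemma continuous_heineSin_integrand (ht : 1 < t) (n : ℕ) :
    Continuous fun x => Real.sin x ^ (2 * n)
      / (2 ^ n * (t - Real.cos x) ^ n * Real.sqrt (t - Real.cos x)) :=
  Continuous.div (by fun_prop) (by fun_prop) fun x => (heineSin_denom_pos ht n x).ne'

lemma heineCos_recurrence (ht : 1 < t) (n : ℕ) :
    ((n : ℝ) + 3 / 2) * heineCos t (n + 2)
      = 2 * (n + 1) * t * heineCos t (n + 1) - ((n : ℝ) + 1 / 2) * heineCos t n := by
  let F (x : ℝ) : ℝ := -2 * (Real.sin ((n + 1) * x) * Real.sqrt (t - Real.cos x))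
  have hF (x : ℝ) : HasDerivAt F
      (((n : ℝ) + 3 / 2) * (Real.cos ((n + 2 : ℕ) * x) / Real.sqrt (t - Real.cos x))
        - 2 * (n + 1) * t * (Real.cos ((n + 1 : ℕ) * x) / Real.sqrt (t - Real.cos x))
        + ((n : ℝ) + 1 / 2) * (Real.cos (n * x) / Real.sqrt (t - Real.cos x))) x := by
    have h1 : HasDerivAt (fun x : ℝ => Real.sin ((n + 1) * x))
        (Real.cos ((n + 1) * x) * (n + 1)) x := by
      have := ((hasDerivAt_id x).const_mul ((n : ℝ) + 1)).sin
      simpa using this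
    refine ((h1.mul (hasDerivAt_sqrt_sub_cos ht x)).const_mul (-2)).congr_deriv ?_
    have hs := Real.sqrt_pos.2 (sub_cos_pos ht x)
    have hsq := Real.sq_sqrt (sub_cos_pos ht x).le
    have e1 : Real.cos ((n + 2 : ℕ) * x) = Real.cos ((n + 1) * x) * Real.cos x
        - Real.sin ((n + 1) * x) * Real.sin x := by
      rw [← Real.cos_add]; congr 1; push_cast; ring
    have e2 : Real.cos (n * x) = Real.cos ((n + 1) * x) * Real.cos x
        + Real.sin ((n + 1) * x) * Real.sin x := by
      rw [← Real.cos_sub]; congr 1; ring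
    have e3 : Real.cos ((n + 1 : ℕ) * x) = Real.cos ((n + 1) * x) := by push_cast; rfl
    rw [e1, e2, e3]
    set s := Real.sqrt (t - Real.cos x)
    field_simp
    rw [hsq]; ring
  have hint (k : ℕ) (c : ℝ) : IntervalIntegrable
      (fun x => c * (Real.cos (k * x) / Real.sqrt (t - Real.cos x))) volume 0 Real.pi :=
    ((continuous_heineCos_integrand ht k).const_mul c).intervalIntegrable _ _
  have hFTC := intervalIntegral.integral_eq_sub_of_hasDerivAt (a := 0) (b := Real.pi)
    (fun x _ => hF x) (((hint _ _).sub (hint _ _)).add (hint _ _))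
  rw [intervalIntegral.integral_add ((hint _ _).sub (hint _ _)) (hint _ _),
    intervalIntegral.integral_sub (hint _ _) (hint _ _)] at hFTC
  simp only [intervalIntegral.integral_const_mul] at hFTC
  have hb : F Real.pi - F 0 = 0 := by
    have := Real.sin_nat_mul_pi (n + 1)
    push_cast at this
    simp [F, this]
  rw [hb] at hFTC
  unfold heineCos
  linarith

/-- The recurrence of `heineCos` for `heineSin`; the integrands add up to the derivative of
`(sin θ)^(2n+1) (t cos θ - (1 + cos² θ)/2) (t - cos θ)^(-n-3/2)`, up to a constant factor. -/
lemma heineSin_recurrence (ht : 1 < t) (n : ℕ) :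
    ((n : ℝ) + 3 / 2) * heineSin t (n + 2)
      = 2 * (n + 1) * t * heineSin t (n + 1) - ((n : ℝ) + 1 / 2) * heineSin t n := by
  let F (x : ℝ) : ℝ := Real.sin x ^ (2 * n + 1) *
    (t * Real.cos x - (1 + Real.cos x ^ 2) / 2)
      / (2 ^ (n + 1) * ((t - Real.cos x) ^ (n + 1) * Real.sqrt (t - Real.cos x)))
  have hF (x : ℝ) : HasDerivAt F
      (((n : ℝ) + 3 / 2) * (Real.sin x ^ (2 * (n + 2))
          / (2 ^ (n + 2) * (t - Real.cos x) ^ (n + 2) * Real.sqrt (t - Real.cos x)))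
        - 2 * (n + 1) * t * (Real.sin x ^ (2 * (n + 1))
          / (2 ^ (n + 1) * (t - Real.cos x) ^ (n + 1) * Real.sqrt (t - Real.cos x)))
        + ((n : ℝ) + 1 / 2) * (Real.sin x ^ (2 * n)
          / (2 ^ n * (t - Real.cos x) ^ n * Real.sqrt (t - Real.cos x)))) x := by
    have hs := Real.sqrt_pos.2 (sub_cos_pos ht x)
    have hd := sub_cos_pos ht x
    have h1 := (Real.hasDerivAt_sin x).pow (2 * n + 1)
    have h2 : HasDerivAt (fun x => t * Real.cos x - (1 + Real.cos x ^ 2) / 2)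
        (-t * Real.sin x + Real.cos x * Real.sin x) x := by
      have a := (Real.hasDerivAt_cos x).const_mul t
      have b := (((Real.hasDerivAt_cos x).pow 2).const_add 1).div_const 2
      refine (a.sub b).congr_deriv ?_
      push_cast; ring
    have h3 : HasDerivAt (fun x => t - Real.cos x) (Real.sin x) x := by
      simpa using (Real.hasDerivAt_cos x).const_sub t
    have h4 := ((h3.pow (n + 1)).mul (hasDerivAt_sqrt_sub_cos ht x)).const_mul
      ((2 : ℝ) ^ (n + 1))
    have h5 := (h1.mul h2).div h4 (by
      simp only [Pi.mul_apply, Pi.pow_apply]; positivity)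
    refine h5.congr_deriv ?_
    have hsq := Real.sq_sqrt hd.le
    have hcs : Real.sin x ^ 2 = 1 - Real.cos x ^ 2 := Real.sin_sq x
    simp only [Pi.mul_apply, Pi.pow_apply, Nat.add_sub_cancel]
    have hds : t - Real.cos x = Real.sqrt (t - Real.cos x) ^ 2 := hsq.symm
    have ht' : t = Real.cos x + Real.sqrt (t - Real.cos x) ^ 2 := by linarith
    have e1 : Real.sin x ^ (2 * n + 1) = Real.sin x ^ (2 * n) * Real.sin x := pow_succ _ _
    have e2 : Real.sin x ^ (2 * (n + 1)) = Real.sin x ^ (2 * n) * Real.sin x ^ 2 := by ring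
    have e3 : Real.sin x ^ (2 * (n + 2)) = Real.sin x ^ (2 * n) * Real.sin x ^ 4 := by ring
    rw [e1, e2, e3, hsq.symm, Real.sqrt_sq hs.le]
    set s := Real.sqrt (t - Real.cos x) with hsdef
    set c := Real.cos x
    set σ := Real.sin x
    set X := σ ^ (2 * n)
    rw [ht']
    clear_value s c σ X
    field_simp
    push_cast
    rw [hcs]
    ring
  have hint (k : ℕ) (c : ℝ) : IntervalIntegrable
      (fun x => c * (Real.sin x ^ (2 * k)
        / (2 ^ k * (t - Real.cos x) ^ k * Real.sqrt (t - Real.cos x)))) volume 0 Real.pi :=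
    ((continuous_heineSin_integrand ht k).const_mul c).intervalIntegrable _ _
  have hFTC := intervalIntegral.integral_eq_sub_of_hasDerivAt (a := 0) (b := Real.pi)
    (fun x _ => hF x) (((hint _ _).sub (hint _ _)).add (hint _ _))
  rw [intervalIntegral.integral_add ((hint _ _).sub (hint _ _)) (hint _ _),
    intervalIntegral.integral_sub (hint _ _) (hint _ _)] at hFTC
  simp only [intervalIntegral.integral_const_mul] at hFTC
  have hb : F Real.pi - F 0 = 0 := by simp [F]
  rw [hb] at hFTC
  unfold heineSin
  linarith

lemma heineCos_zero (t : ℝ) : heineCos t 0 = heineSin t 0 := by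
  simp [heineCos, heineSin]

lemma heineCos_one (ht : 1 < t) : heineCos t 1 = heineSin t 1 := by
  let F (x : ℝ) : ℝ := Real.sin x / Real.sqrt (t - Real.cos x)
  have hF (x : ℝ) : HasDerivAt F (Real.cos ((1 : ℕ) * x) / Real.sqrt (t - Real.cos x)
      - Real.sin x ^ (2 * 1)
        / (2 ^ 1 * (t - Real.cos x) ^ 1 * Real.sqrt (t - Real.cos x))) x := by
    have hd := sub_cos_pos ht x
    have hs := Real.sqrt_pos.2 hd
    refine ((Real.hasDerivAt_sin x).div (hasDerivAt_sqrt_sub_cos ht x) hs.ne').congr_deriv ?_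
    have hsq := Real.sq_sqrt hd.le
    simp only [Nat.cast_one, one_mul, pow_one, mul_one]
    rw [← hsq]
    rw [Real.sqrt_sq hs.le]
    field_simp
  have hc := (continuous_heineCos_integrand ht 1).intervalIntegrable (μ := volume) 0 Real.pi
  have hs := (continuous_heineSin_integrand ht 1).intervalIntegrable (μ := volume) 0 Real.pi
  have hFTC := intervalIntegral.integral_eq_sub_of_hasDerivAt (a := 0) (b := Real.pi)
    (fun x _ => hF x) (hc.sub hs)
  rw [intervalIntegral.integral_sub hc hs] at hFTC
  have hb : F Real.pi - F 0 = 0 := by simp [F]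
  rw [hb] at hFTC
  unfold heineCos heineSin
  linarith

lemma heineCos_eq_heineSin (ht : 1 < t) (n : ℕ) : heineCos t n = heineSin t n := by
  induction n using Nat.twoStepInduction with
  | zero => exact heineCos_zero t
  | one => exact heineCos_one ht
  | more n h0 h1 =>
    have a := heineCos_recurrence ht n
    have b := heineSin_recurrence ht n
    rw [h0, h1, ← b] at a
    exact mul_left_cancel₀ (by positivity) a

/-- The integral in `Q_{n-1/2}` in the variable `s = cos θ`. -/
lemma integral_legendre_eq_heineSin (ht : 1 < t) (n : ℕ) :
    ∫ s in (-1 : ℝ)..1, (1 - s ^ 2) ^ ((n : ℝ) - 1 / 2) / (t - s) ^ ((n : ℝ) - 1 / 2 + 1)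
      = 2 ^ n * heineSin t n := by
  have hinj : InjOn Real.cos (Ioo 0 Real.pi) := Real.injOn_cos.mono Ioo_subset_Icc_self
  have himg : Real.cos '' Ioo 0 Real.pi = Ioo (-1) 1 := by
    ext y; constructor
    · rintro ⟨x, hx, rfl⟩
      have h1 := Real.cos_lt_cos_of_nonneg_of_le_pi le_rfl hx.2.le hx.1
      have h2 := Real.cos_lt_cos_of_nonneg_of_le_pi hx.1.le le_rfl hx.2
      simp only [Real.cos_zero, Real.cos_pi] at h1 h2
      exact ⟨h2, h1⟩
    · rintro ⟨h1, h2⟩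
      refine ⟨Real.arccos y, ⟨Real.arccos_pos.2 h2, ?_⟩, Real.cos_arccos h1.le h2.le⟩
      exact lt_of_le_of_ne (Real.arccos_le_pi y) fun h =>
        absurd (Real.arccos_eq_pi.1 h) (not_le.2 h1)
  unfold heineSin
  rw [← intervalIntegral.integral_const_mul, intervalIntegral.integral_of_le (by norm_num),
    intervalIntegral.integral_of_le Real.pi_pos.le, integral_Ioc_eq_integral_Ioo,
    integral_Ioc_eq_integral_Ioo, ← himg,
    integral_image_eq_integral_abs_deriv_smul measurableSet_Ioo
      (fun x _ => (Real.hasDerivAt_cos x).hasDerivWithinAt) hinj]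
  refine setIntegral_congr_fun measurableSet_Ioo fun x hx => ?_
  have hsin : 0 < Real.sin x := Real.sin_pos_of_mem_Ioo hx
  have hd := sub_cos_pos ht x
  have h1 : (1 - Real.cos x ^ 2) ^ ((n : ℝ) - 1 / 2) = Real.sin x ^ (2 * n) / Real.sin x := by
    rw [← Real.sin_sq, Real.rpow_sub (by positivity), Real.rpow_natCast, ← pow_mul,
      ← Real.sqrt_eq_rpow, Real.sqrt_sq hsin.le]
  have h2 : (t - Real.cos x) ^ ((n : ℝ) - 1 / 2 + 1)
      = (t - Real.cos x) ^ n * Real.sqrt (t - Real.cos x) := by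
    rw [show (n : ℝ) - 1 / 2 + 1 = n + 1 / 2 by ring, Real.rpow_add hd, Real.rpow_natCast,
      ← Real.sqrt_eq_rpow]
  have hs := Real.sqrt_pos.2 hd
  simp only [smul_eq_mul, abs_neg, abs_of_pos hsin]
  rw [h1, h2]
  field_simp

/-- Heine's formula: the Fourier coefficients of `(cosh η₀ - cos θ)^(-1/2)` are the toroidal
functions `Q_{n-1/2}(cosh η₀)`. -/
lemma heineCos_eq_q {η₀ : ℝ} (hη₀ : 0 < η₀) (n : ℕ) :
    heineCos (Real.cosh η₀) n = Real.sqrt 2 * q η₀ n 0 := by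
  have ht : 1 < Real.cosh η₀ := Real.one_lt_cosh.2 hη₀.ne'
  have hG : Real.Gamma ((n : ℝ) - 1 / 2 + 1) ≠ 0 :=
    (Real.Gamma_pos_of_pos (by have : (0 : ℝ) ≤ n := n.cast_nonneg; linarith)).ne'
  unfold q legendreQ
  simp only [Nat.cast_zero, add_zero, pow_zero, zero_div, Real.rpow_zero, mul_one]
  rw [div_self hG, integral_legendre_eq_heineSin ht, heineCos_eq_heineSin ht,
    show (n : ℝ) - 1 / 2 + 1 = n + 1 / 2 by ring, Real.rpow_add two_pos, Real.rpow_natCast,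
    ← Real.sqrt_eq_rpow]
  have : Real.sqrt 2 ≠ 0 := by positivity
  field_simp

end Heine

/-! ### Geometry of the toroidal coordinates -/

/-- The toroidal parametrization, as a function of the triple `(η, θ, φ)`. -/
noncomputable def tripleMap (y : ℝ × ℝ × ℝ) : E3 := point y.1 y.2.1 y.2.2

lemma cosh_sub_cos_pos {η : ℝ} (hη : 0 < η) (θ : ℝ) : 0 < Real.cosh η - Real.cos θ :=
  sub_cos_pos (Real.one_lt_cosh.2 hη.ne') θ

lemma hasDerivAt_vec3 {f₀ f₁ f₂ : ℝ → ℝ} {a₀ a₁ a₂ x : ℝ} (h₀ : HasDerivAt f₀ a₀ x)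
    (h₁ : HasDerivAt f₁ a₁ x) (h₂ : HasDerivAt f₂ a₂ x) :
    HasDerivAt (fun x => (!₂[f₀ x, f₁ x, f₂ x] : E3)) !₂[a₀, a₁, a₂] x := by
  have h : HasDerivAt (fun x => (![f₀ x, f₁ x, f₂ x] : Fin 3 → ℝ)) ![a₀, a₁, a₂] x := by
    rw [hasDerivAt_pi]
    intro i
    fin_cases i
    · exact h₀
    · exact h₁
    · exact h₂
  exact (PiLp.continuousLinearEquiv 2 ℝ
    (fun _ : Fin 3 => ℝ)).symm.hasFDerivAt.comp_hasDerivAt x h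

/-- The coordinate tangent vector `∂x/∂η`. -/
noncomputable def tangentEta (η θ φ : ℝ) : E3 :=
  !₂[-(Real.sin θ * Real.sinh η) / (Real.cosh η - Real.cos θ) ^ 2,
    Real.cos φ * (1 - Real.cosh η * Real.cos θ) / (Real.cosh η - Real.cos θ) ^ 2,
    Real.sin φ * (1 - Real.cosh η * Real.cos θ) / (Real.cosh η - Real.cos θ) ^ 2]

/-- The coordinate tangent vector `∂x/∂θ`. -/
noncomputable def tangentTheta (η θ φ : ℝ) : E3 :=
  !₂[(Real.cosh η * Real.cos θ - 1) / (Real.cosh η - Real.cos θ) ^ 2,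
    -(Real.cos φ * (Real.sinh η * Real.sin θ)) / (Real.cosh η - Real.cos θ) ^ 2,
    -(Real.sin φ * (Real.sinh η * Real.sin θ)) / (Real.cosh η - Real.cos θ) ^ 2]

/-- The coordinate tangent vector `∂x/∂φ`. -/
noncomputable def tangentPhi (η θ φ : ℝ) : E3 :=
  !₂[0, -(Real.sinh η * Real.sin φ) / (Real.cosh η - Real.cos θ),
    Real.sinh η * Real.cos φ / (Real.cosh η - Real.cos θ)]

lemma hasDerivAt_point_eta {η : ℝ} (hη : 0 < η) (θ φ : ℝ) :
    HasDerivAt (fun η => point η θ φ) (tangentEta η θ φ) η := by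
  have hD := cosh_sub_cos_pos hη θ
  have h1 : HasDerivAt (fun η => Real.cosh η - Real.cos θ) (Real.sinh η) η :=
    (Real.hasDerivAt_cosh η).sub_const _
  have hc := Real.cosh_sq η
  refine hasDerivAt_vec3 (((hasDerivAt_const η (Real.sin θ)).div h1 hD.ne').congr_deriv ?_)
    ((((Real.hasDerivAt_sinh η).mul_const (Real.cos φ)).div h1 hD.ne').congr_deriv ?_)
    ((((Real.hasDerivAt_sinh η).mul_const (Real.sin φ)).div h1 hD.ne').congr_deriv ?_)
  · ring
  · congr 1; linear_combination Real.cos φ * hc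
  · congr 1; linear_combination Real.sin φ * hc

lemma hasDerivAt_point_theta {η : ℝ} (hη : 0 < η) (θ φ : ℝ) :
    HasDerivAt (fun θ => point η θ φ) (tangentTheta η θ φ) θ := by
  have hD := cosh_sub_cos_pos hη θ
  have h1 : HasDerivAt (fun θ => Real.cosh η - Real.cos θ) (Real.sin θ) θ := by
    simpa using (Real.hasDerivAt_cos θ).const_sub (Real.cosh η)
  have hc := Real.sin_sq_add_cos_sq θ
  refine hasDerivAt_vec3 (((Real.hasDerivAt_sin θ).div h1 hD.ne').congr_deriv ?_)
    (((hasDerivAt_const θ _).div h1 hD.ne').congr_deriv ?_)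
    (((hasDerivAt_const θ _).div h1 hD.ne').congr_deriv ?_)
  · congr 1; linear_combination -hc
  · ring
  · ring

lemma hasDerivAt_point_phi (η θ φ : ℝ) :
    HasDerivAt (fun φ => point η θ φ) (tangentPhi η θ φ) φ := by
  refine hasDerivAt_vec3 (hasDerivAt_const φ _)
    ((((Real.hasDerivAt_cos φ).const_mul (Real.sinh η)).div_const _).congr_deriv ?_)
    (((Real.hasDerivAt_sin φ).const_mul (Real.sinh η)).div_const _)
  ring

lemma areaElement_eq {η : ℝ} (hη : 0 < η) (p : ℝ × ℝ) :
    areaElement η p = Real.sinh η / (Real.cosh η - Real.cos p.1) ^ 2 := by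
  have hD := cosh_sub_cos_pos hη p.1
  have hs : 0 < Real.sinh η := Real.sinh_pos_iff.2 hη
  have h1 := Real.sin_sq_add_cos_sq p.1
  have h2 := Real.sin_sq_add_cos_sq p.2
  have h3 := Real.cosh_sq η
  unfold areaElement
  rw [(hasDerivAt_point_theta hη p.1 p.2).deriv, (hasDerivAt_point_phi η p.1 p.2).deriv]
  have e1 : ‖tangentTheta η p.1 p.2‖ ^ 2 = 1 / (Real.cosh η - Real.cos p.1) ^ 2 := by
    rw [EuclideanSpace.norm_sq_eq, Fin.sum_univ_three]
    simp only [tangentTheta, Real.norm_eq_abs, sq_abs]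
    simp only [Matrix.cons_val]
    rw [div_pow, div_pow, div_pow, ← add_div, ← add_div,
      div_eq_div_iff (by positivity) (by positivity)]
    have : (Real.cosh η * Real.cos p.1 - 1) ^ 2 + (-(Real.cos p.2 * (Real.sinh η * Real.sin p.1))) ^ 2
      + (-(Real.sin p.2 * (Real.sinh η * Real.sin p.1))) ^ 2
        = (Real.cosh η - Real.cos p.1) ^ 2 := by
      linear_combination (Real.sinh η * Real.sin p.1) ^ 2 * h2 - Real.sin p.1 ^ 2 * h3
        + (Real.cosh η ^ 2 - 1) * h1
    rw [this]; ring
  have e2 : ‖tangentPhi η p.1 p.2‖ ^ 2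
      = Real.sinh η ^ 2 / (Real.cosh η - Real.cos p.1) ^ 2 := by
    rw [EuclideanSpace.norm_sq_eq, Fin.sum_univ_three]
    simp only [tangentPhi, Real.norm_eq_abs, sq_abs]
    simp only [Matrix.cons_val]
    rw [div_pow, div_pow]
    field_simp
    linear_combination Real.sinh η ^ 2 * h2
  have e3 : ⟪tangentTheta η p.1 p.2, tangentPhi η p.1 p.2⟫_ℝ = 0 := by
    rw [PiLp.inner_apply, Fin.sum_univ_three]
    simp only [tangentTheta, tangentPhi, RCLike.inner_apply, conj_trivial]
    simp only [Matrix.cons_val]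
    ring
  rw [e1, e2, e3]
  rw [show 1 / (Real.cosh η - Real.cos p.1) ^ 2 * (Real.sinh η ^ 2
    / (Real.cosh η - Real.cos p.1) ^ 2) - 0 ^ 2
      = (Real.sinh η / (Real.cosh η - Real.cos p.1) ^ 2) ^ 2 by field_simp; ring]
  exact Real.sqrt_sq (by positivity)

lemma contDiffAt_tripleMap {y : ℝ × ℝ × ℝ} (hy : 0 < y.1) : ContDiffAt ℝ ∞ tripleMap y := by
  have hD := cosh_sub_cos_pos hy y.2.1
  rw [contDiffAt_piLp]
  have hc : ContDiffAt ℝ ∞ (fun y : ℝ × ℝ × ℝ => Real.cosh y.1 - Real.cos y.2.1) y :=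
    (Real.contDiff_cosh.contDiffAt.comp y contDiffAt_fst).sub
      (Real.contDiff_cos.contDiffAt.comp y (by fun_prop))
  have hsh : ContDiffAt ℝ ∞ (fun y : ℝ × ℝ × ℝ => Real.sinh y.1) y :=
    Real.contDiff_sinh.contDiffAt.comp y contDiffAt_fst
  intro i
  fin_cases i
  · exact (Real.contDiff_sin.contDiffAt.comp y (by fun_prop :
      ContDiffAt ℝ ∞ (fun y : ℝ × ℝ × ℝ => y.2.1) y)).div hc hD.ne'
  · exact (hsh.mul (Real.contDiff_cos.contDiffAt.comp y (by fun_prop :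
      ContDiffAt ℝ ∞ (fun y : ℝ × ℝ × ℝ => y.2.2) y))).div hc hD.ne'
  · exact (hsh.mul (Real.contDiff_sin.contDiffAt.comp y (by fun_prop :
      ContDiffAt ℝ ∞ (fun y : ℝ × ℝ × ℝ => y.2.2) y))).div hc hD.ne'

lemma isOpen_eta_pos : IsOpen {y : ℝ × ℝ × ℝ | 0 < y.1} :=
  isOpen_lt continuous_const continuous_fst

lemma contDiffOn_tripleMap : ContDiffOn ℝ ∞ tripleMap {y | 0 < y.1} :=
  fun _ hy => (contDiffAt_tripleMap hy).contDiffWithinAt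

lemma measurable_tripleMap : Measurable tripleMap := by
  unfold tripleMap point
  refine (WithLp.measurable_toLp 2 (Fin 3 → ℝ)).comp ?_
  rw [measurable_pi_iff]
  intro i
  fin_cases i
  all_goals
    simp only [Fin.zero_eta, Fin.mk_one, Fin.reduceFinMk, Matrix.cons_val]
    fun_prop

lemma measurable_point (η : ℝ) : Measurable fun p : ℝ × ℝ => point η p.1 p.2 := by
  have h : Measurable fun p : ℝ × ℝ => ((η, p) : ℝ × ℝ × ℝ) := by fun_prop
  have h2 := measurable_tripleMap.comp h
  simpa only [Function.comp_def, tripleMap] using h2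

/-- The toroidal coordinates are regular: the tangent vectors are linearly independent. -/
lemma fderiv_tripleMap_eq_zero {y : ℝ × ℝ × ℝ} (hy : 0 < y.1) {v : ℝ × ℝ × ℝ}
    (hv : fderiv ℝ tripleMap y v = 0) : v = 0 := by
  obtain ⟨η, θ, φ⟩ := y
  obtain ⟨a, b, c⟩ := v
  simp only at hy
  have hd := ((contDiffAt_tripleMap (y := (η, θ, φ)) hy).differentiableAt (by simp)).hasFDerivAt
  have k1 : fderiv ℝ tripleMap (η, θ, φ) (1, 0, 0) = tangentEta η θ φ := by
    have := hd.comp_hasDerivAt η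
      ((hasDerivAt_id η).prodMk ((hasDerivAt_const η θ).prodMk (hasDerivAt_const η φ)))
    exact this.unique (hasDerivAt_point_eta hy θ φ)
  have k2 : fderiv ℝ tripleMap (η, θ, φ) (0, 1, 0) = tangentTheta η θ φ := by
    have := hd.comp_hasDerivAt θ
      ((hasDerivAt_const θ η).prodMk ((hasDerivAt_id θ).prodMk (hasDerivAt_const θ φ)))
    exact this.unique (hasDerivAt_point_theta hy θ φ)
  have k3 : fderiv ℝ tripleMap (η, θ, φ) (0, 0, 1) = tangentPhi η θ φ := by
    have := hd.comp_hasDerivAt φ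
      ((hasDerivAt_const φ η).prodMk ((hasDerivAt_const φ θ).prodMk (hasDerivAt_id φ)))
    exact this.unique (hasDerivAt_point_phi η θ φ)
  have hsplit : ((a, b, c) : ℝ × ℝ × ℝ)
      = a • ((1, 0, 0) : ℝ × ℝ × ℝ) + b • ((0, 1, 0) : ℝ × ℝ × ℝ) + c • ((0, 0, 1) : ℝ × ℝ × ℝ) := by
    simp
  rw [hsplit, map_add, map_add, map_smul, map_smul, map_smul, k1, k2, k3] at hv
  have hD := cosh_sub_cos_pos hy θ
  have hs : 0 < Real.sinh η := Real.sinh_pos_iff.2 hy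
  have q0 := congrArg (fun x : E3 => x 0) hv
  have q1 := congrArg (fun x : E3 => x 1) hv
  have q2 := congrArg (fun x : E3 => x 2) hv
  simp only [tangentEta, tangentTheta, tangentPhi, PiLp.add_apply, PiLp.smul_apply,
    PiLp.zero_apply, smul_eq_mul] at q0 q1 q2
  simp only [Matrix.cons_val] at q0 q1 q2
  have h1 := Real.sin_sq_add_cos_sq θ
  have h2 := Real.sin_sq_add_cos_sq φ
  have h3 := Real.cosh_sq η
  set D := Real.cosh η - Real.cos θ with hDdef
  set A := 1 - Real.cosh η * Real.cos θ with hA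
  set B := Real.sinh η * Real.sin θ with hB
  -- `(A, B) / D` is a unit vector, so the tangent vectors `∂x/∂η`, `∂x/∂θ` are orthogonal of equal
  -- length, and the equations below invert a multiple of a rotation.
  have hAB : A ^ 2 + B ^ 2 = D ^ 2 := by
    rw [hA, hB, hDdef]
    linear_combination - Real.sin θ ^ 2 * h3 + (Real.cosh η ^ 2 - 1) * h1
  have r0 : a * B + b * A = 0 := by
    field_simp at q0
    linear_combination -q0
  field_simp at q1 q2
  have r1 : a * A - b * B = 0 := by
    linear_combination Real.cos φ * q1 + Real.sin φ * q2 - (a * A - b * B) * h2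
  have r2 : c * (D * Real.sinh η) = 0 := by
    linear_combination -Real.sin φ * q1 + Real.cos φ * q2 - c * (D * Real.sinh η) * h2
  have ha : a * D ^ 2 = 0 := by
    rw [← hAB]; linear_combination A * r1 + B * r0
  have hb : b * D ^ 2 = 0 := by
    rw [← hAB]; linear_combination A * r0 - B * r1
  have hD2 : D ^ 2 ≠ 0 := by positivity
  have hc : c = 0 := (mul_eq_zero.1 r2).resolve_right (by positivity)
  have ha : a = 0 := (mul_eq_zero.1 ha).resolve_right hD2
  have hb : b = 0 := (mul_eq_zero.1 hb).resolve_right hD2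
  rw [ha, hb, hc]; rfl

lemma eq_of_cos_eq_of_sin_eq {a b : ℝ} (ha : a ∈ Ioc (-Real.pi) Real.pi)
    (hb : b ∈ Ioc (-Real.pi) Real.pi) (hc : Real.cos a = Real.cos b)
    (hs : Real.sin a = Real.sin b) : a = b := by
  rw [← Real.Angle.toReal_coe_eq_self_iff_mem_Ioc.2 ha,
    ← Real.Angle.toReal_coe_eq_self_iff_mem_Ioc.2 hb, Real.Angle.cos_sin_inj hc hs]

lemma norm_sq_point_add_one {η : ℝ} (hη : 0 < η) (θ φ : ℝ) :
    ‖point η θ φ‖ ^ 2 + 1 = 2 * Real.cosh η / (Real.cosh η - Real.cos θ) := by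
  have hD := cosh_sub_cos_pos hη θ
  have h1 := Real.sin_sq_add_cos_sq θ
  have h2 := Real.sin_sq_add_cos_sq φ
  have h3 := Real.cosh_sq η
  rw [EuclideanSpace.norm_sq_eq, Fin.sum_univ_three]
  simp only [point, Real.norm_eq_abs, sq_abs]
  simp only [Matrix.cons_val]
  field_simp
  linear_combination h1 + Real.sinh η ^ 2 * h2 - h3

/-- The toroidal coordinates are unique away from the axis and the limiting circle. -/
lemma injOn_tripleMap : InjOn tripleMap
    {y | 0 < y.1 ∧ y.2.1 ∈ Ioc (-Real.pi) Real.pi ∧ y.2.2 ∈ Ioc (-Real.pi) Real.pi} := by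
  rintro ⟨η, θ, φ⟩ ⟨h1, h2, h3⟩ ⟨η', θ', φ'⟩ ⟨h1', h2', h3'⟩ h
  simp only at h1 h2 h3 h1' h2' h3'
  simp only [tripleMap] at h
  have hD := cosh_sub_cos_pos h1 θ
  have hD' := cosh_sub_cos_pos h1' θ'
  have hs : 0 < Real.sinh η := Real.sinh_pos_iff.2 h1
  have hs' : 0 < Real.sinh η' := Real.sinh_pos_iff.2 h1'
  have n := norm_sq_point_add_one h1 θ φ
  rw [h, norm_sq_point_add_one h1' θ' φ'] at n
  have q0 := congrArg (fun x : E3 => x 0) h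
  have q1 := congrArg (fun x : E3 => x 1) h
  have q2 := congrArg (fun x : E3 => x 2) h
  simp only [point] at q0 q1 q2
  simp only [Matrix.cons_val] at q0 q1 q2
  set D := Real.cosh η - Real.cos θ with hDdef
  set D' := Real.cosh η' - Real.cos θ' with hDdef'
  have hch : Real.cosh η / D = Real.cosh η' / D' := by
    rw [mul_div_assoc, mul_div_assoc] at n; linarith
  have hco : Real.cos θ / D = Real.cos θ' / D' := by
    have e1 : Real.cosh η / D - Real.cos θ / D = 1 := by rw [← sub_div, ← hDdef, div_self hD.ne']
    have e2 : Real.cosh η' / D' - Real.cos θ' / D' = 1 := by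
      rw [← sub_div, ← hDdef', div_self hD'.ne']
    linarith
  -- `1 / D` is the norm of `(cos θ / D, sin θ / D)`, and both entries are functions of the point.
  have hinv : D = D' := by
    have e1 : (Real.cos θ / D) ^ 2 + (Real.sin θ / D) ^ 2 = (1 / D) ^ 2 := by
      rw [div_pow, div_pow, ← add_div, Real.cos_sq_add_sin_sq, div_pow, one_pow]
    have e2 : (Real.cos θ' / D') ^ 2 + (Real.sin θ' / D') ^ 2 = (1 / D') ^ 2 := by
      rw [div_pow, div_pow, ← add_div, Real.cos_sq_add_sin_sq, div_pow, one_pow]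
    rw [hco, q0, e2] at e1
    have := (pow_left_inj₀ (by positivity) (by positivity) two_ne_zero).1 e1
    simpa using this.symm
  rw [← hinv] at hch hco q0 q1 q2
  have g {x y : ℝ} (hxy : x / D = y / D) : x = y := (div_left_inj' hD.ne').1 hxy
  have hη : η = η' := by
    exact Real.cosh_strictMonoOn.injOn h1.le h1'.le (g hch)
  subst hη
  have hθ : θ = θ' := eq_of_cos_eq_of_sin_eq h2 h2' (g hco) (g q0)
  have hφ : φ = φ' := eq_of_cos_eq_of_sin_eq h3 h3' (mul_left_cancel₀ hs.ne' (g q1))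
    (mul_left_cancel₀ hs.ne' (g q2))
  rw [hθ, hφ]

lemma isBounded_solidTorus {η₀ : ℝ} (hη₀ : 0 < η₀) : Bornology.IsBounded (solidTorus η₀) := by
  have h1 : 1 < Real.cosh η₀ := Real.one_lt_cosh.2 hη₀.ne'
  rw [isBounded_iff_forall_norm_le]
  refine ⟨1 + 2 * Real.cosh η₀ / (Real.cosh η₀ - 1), ?_⟩
  have hpos : 0 < 2 * Real.cosh η₀ / (Real.cosh η₀ - 1) := div_pos (by linarith) (by linarith)
  have key {x : E3} (hx : ‖x‖ ^ 2 ≤ 1 + 2 * Real.cosh η₀ / (Real.cosh η₀ - 1)) :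
      ‖x‖ ≤ 1 + 2 * Real.cosh η₀ / (Real.cosh η₀ - 1) := by
    by_contra! hlt
    nlinarith [norm_nonneg x]
  rintro x (⟨η, θ, φ, hη, rfl⟩ | ⟨hx0, hx1⟩)
  · refine key ?_
    have hpos' := hη₀.trans hη
    have h2 := norm_sq_point_add_one hpos' θ φ
    have hD := cosh_sub_cos_pos hpos' θ
    have h3 : Real.cosh η₀ < Real.cosh η := Real.cosh_lt_cosh.2 (by
      rwa [abs_of_pos hη₀, abs_of_pos hpos'])
    have : 2 * Real.cosh η / (Real.cosh η - Real.cos θ)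
        ≤ 2 * Real.cosh η₀ / (Real.cosh η₀ - 1) := by
      rw [div_le_div_iff₀ hD (by linarith)]
      nlinarith [Real.cos_le_one θ, mul_nonneg (by linarith : (0 : ℝ) ≤ Real.cosh η₀)
        (by linarith [Real.cos_le_one θ] : 0 ≤ 1 - Real.cos θ)]
    linarith
  · refine key ?_
    rw [EuclideanSpace.norm_sq_eq, Fin.sum_univ_three]
    simp only [Real.norm_eq_abs, sq_abs]
    rw [hx0]
    linarith

lemma isFiniteMeasure_volTorus {η₀ : ℝ} (hη₀ : 0 < η₀) : IsFiniteMeasure (volTorus η₀) :=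
  isFiniteMeasure_restrict.2 (isBounded_solidTorus hη₀).measure_lt_top.ne

lemma squareMeasure_eq_restrict : squareMeasure
    = volume.restrict (Ioc (-Real.pi) Real.pi ×ˢ Ioc (-Real.pi) Real.pi) := by
  rw [Measure.volume_eq_prod, ← Measure.prod_restrict]

lemma squareMeasure_ne_zero : squareMeasure ≠ 0 := by
  have hp := Real.pi_pos
  rw [← Measure.measure_univ_ne_zero, ← univ_prod_univ, Measure.prod_prod]
  have h : periodMeasure univ ≠ 0 := by
    rw [Measure.restrict_apply_univ, Real.volume_Ioc, ne_eq, ENNReal.ofReal_eq_zero]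
    linarith
  exact mul_ne_zero h h

/-- The surface measure is bounded by a multiple of Lebesgue measure on the parameter square. -/
lemma exists_surfaceParam_le {η₀ : ℝ} (hη₀ : 0 < η₀) :
    ∃ C : ℝ≥0∞, C ≠ 0 ∧ C ≠ ⊤ ∧ surfaceParam η₀ ≤ C • squareMeasure := by
  have h1 : 1 < Real.cosh η₀ := Real.one_lt_cosh.2 hη₀.ne'
  have hs : 0 < Real.sinh η₀ := Real.sinh_pos_iff.2 hη₀
  refine ⟨ENNReal.ofReal (Real.sinh η₀ / (Real.cosh η₀ - 1) ^ 2), ?_, ENNReal.ofReal_ne_top, ?_⟩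
  · have : 0 < Real.cosh η₀ - 1 := by linarith
    simp only [ne_eq, ENNReal.ofReal_eq_zero, not_le]; positivity
  rw [surfaceParam, ← squareMeasure_eq_restrict, ← withDensity_const]
  refine withDensity_mono (ae_of_all _ fun p => ENNReal.ofReal_le_ofReal ?_)
  rw [areaElement_eq hη₀]
  have := Real.cos_le_one p.1
  have : 0 < Real.cosh η₀ - 1 := by linarith
  gcongr

/-- Lebesgue measure on the parameter square is bounded by a multiple of the surface measure. -/
lemma exists_squareMeasure_le {η₀ : ℝ} (hη₀ : 0 < η₀) :
    ∃ C : ℝ≥0∞, C ≠ 0 ∧ C ≠ ⊤ ∧ squareMeasure ≤ C • surfaceParam η₀ := by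
  have h1 : 1 < Real.cosh η₀ := Real.one_lt_cosh.2 hη₀.ne'
  have hs : 0 < Real.sinh η₀ := Real.sinh_pos_iff.2 hη₀
  set r := Real.sinh η₀ / (Real.cosh η₀ + 1) ^ 2 with hr
  have hrpos : 0 < r := by positivity
  refine ⟨ENNReal.ofReal r⁻¹, ?_, ENNReal.ofReal_ne_top, ?_⟩
  · simp only [ne_eq, ENNReal.ofReal_eq_zero, not_le]; positivity
  rw [surfaceParam, ← squareMeasure_eq_restrict, ← withDensity_smul' _ _ ENNReal.ofReal_ne_top]
  conv_lhs => rw [← withDensity_one (μ := squareMeasure)]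
  refine withDensity_mono (ae_of_all _ fun p => ?_)
  simp only [Pi.one_apply, Pi.smul_apply, smul_eq_mul]
  rw [← ENNReal.ofReal_mul (by positivity), ← ENNReal.ofReal_one]
  refine ENNReal.ofReal_le_ofReal ?_
  rw [areaElement_eq hη₀, ← div_eq_inv_mul, one_le_div hrpos, hr]
  have := Real.neg_one_le_cos p.1
  have := cosh_sub_cos_pos hη₀ p.1
  gcongr
  linarith

lemma lintegral_surfaceMeasure {η₀ : ℝ} {F : E3 → ℝ≥0∞} (hF : Measurable F) :
    ∫⁻ x, F x ∂surfaceMeasure η₀ = ∫⁻ p, F (point η₀ p.1 p.2) ∂surfaceParam η₀ := by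
  rw [surfaceMeasure, lintegral_map hF (measurable_point η₀)]

lemma ae_surfaceMeasure_iff {η₀ : ℝ} {Q : E3 → Prop} (hQ : MeasurableSet {x | Q x}) :
    (∀ᵐ x ∂surfaceMeasure η₀, Q x) ↔ ∀ᵐ p ∂surfaceParam η₀, Q (point η₀ p.1 p.2) := by
  rw [surfaceMeasure, ae_map_iff (measurable_point η₀).aemeasurable hQ]

lemma isFiniteMeasure_surfaceParam {η₀ : ℝ} (hη₀ : 0 < η₀) :
    IsFiniteMeasure (surfaceParam η₀) := by
  obtain ⟨C, -, hC, hle⟩ := exists_surfaceParam_le hη₀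
  refine ⟨(hle univ).trans_lt ?_⟩
  rw [Measure.smul_apply, smul_eq_mul]
  exact ENNReal.mul_lt_top hC.lt_top (measure_lt_top _ _)

lemma isFiniteMeasure_surfaceMeasure {η₀ : ℝ} (hη₀ : 0 < η₀) :
    IsFiniteMeasure (surfaceMeasure η₀) := by
  have := isFiniteMeasure_surfaceParam hη₀
  unfold surfaceMeasure
  infer_instance

lemma area_pos {η₀ : ℝ} (hη₀ : 0 < η₀) : 0 < area η₀ := by
  have := isFiniteMeasure_surfaceMeasure hη₀
  unfold area
  rw [measureReal_def, ENNReal.toReal_pos_iff]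
  refine ⟨pos_iff_ne_zero.2 fun h => ?_, measure_lt_top _ _⟩
  rw [surfaceMeasure, Measure.map_apply (measurable_point η₀) MeasurableSet.univ,
    preimage_univ] at h
  obtain ⟨C, -, -, hle⟩ := exists_squareMeasure_le hη₀
  have h0 := hle univ
  rw [Measure.smul_apply, h, smul_zero] at h0
  exact squareMeasure_ne_zero (Measure.measure_univ_eq_zero.1 (le_antisymm h0 zero_le))

/-! ### Oscillation estimate on a shell -/

lemma enorm_sub_le_lintegral {φ φ' : ℝ → ℝ} {a b : ℝ}
    (hφ : ∀ x ∈ Icc a b, HasDerivAt φ (φ' x) x) (hc : ContinuousOn φ' (Icc a b))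
    {G : ℝ → ℝ≥0∞} (hG : ∀ x ∈ Icc a b, ‖φ' x‖ₑ ≤ G x)
    {x y : ℝ} (hx : x ∈ Icc a b) (hy : y ∈ Icc a b) :
    ‖φ x - φ y‖ₑ ≤ ∫⁻ s in Ioc a b, G s := by
  have hsub : uIcc y x ⊆ Icc a b := ordConnected_Icc.uIcc_subset hy hx
  rw [← intervalIntegral.integral_eq_sub_of_hasDerivAt (fun s hs => hφ s (hsub hs))
    (hc.mono hsub).intervalIntegrable, ← ofReal_norm, intervalIntegral.norm_integral_eq_norm_integral_uIoc,
    ofReal_norm]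
  have hsub' : uIoc y x ⊆ Ioc a b := by
    rw [uIoc]; exact Ioc_subset_Ioc (le_min hy.1 hx.1) (max_le hy.2 hx.2)
  refine (enorm_integral_le_lintegral_enorm _).trans ((lintegral_mono_set hsub').trans ?_)
  exact setLIntegral_mono' measurableSet_Ioc fun s hs => hG s (Ioc_subset_Icc_self hs)

/-- Lebesgue measure on the parameters of the shell `η₀ < η ≤ η₀ + 1`. -/
noncomputable abbrev shellMeasure (η₀ : ℝ) : Measure (ℝ × ℝ × ℝ) :=
  (volume.restrict (Ioc η₀ (η₀ + 1))).prod squareMeasure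

/-- The closed parameter box of the shell `η₀ ≤ η ≤ η₀ + 1`. -/
def closedBox (η₀ : ℝ) : Set (ℝ × ℝ × ℝ) :=
  Icc η₀ (η₀ + 1) ×ˢ Icc (-Real.pi) Real.pi ×ˢ Icc (-Real.pi) Real.pi

lemma isCompact_closedBox (η₀ : ℝ) : IsCompact (closedBox η₀) :=
  isCompact_Icc.prod (isCompact_Icc.prod isCompact_Icc)

lemma eta_pos_of_mem_closedBox {η₀ : ℝ} (hη₀ : 0 < η₀) {y : ℝ × ℝ × ℝ}
    (hy : y ∈ closedBox η₀) : 0 < y.1 := hη₀.trans_le hy.1.1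

/-- The oscillation on the face `η = η₀` of a function on the parameter box is controlled by its
gradient in the box: two points of the face are joined by the path that moves inward to a height
`η`, then along the two coordinate directions, and back; averaging over `η` replaces the integral
along the path by one over the box. -/
lemma lintegral_oscillation_le {η₀ : ℝ} {W : ℝ × ℝ × ℝ → ℝ} {U : Set (ℝ × ℝ × ℝ)}
    (hU : IsOpen U) (hW : ContDiffOn ℝ 1 W U) (hbox : closedBox η₀ ⊆ U)
    {G : ℝ × ℝ × ℝ → ℝ≥0∞} (hG : Measurable G)
    (hb : ∀ y ∈ closedBox η₀, ‖fderiv ℝ W y‖ₑ ≤ G y) :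
    ∫⁻ p, ∫⁻ p', ‖W (η₀, p) - W (η₀, p')‖ₑ ∂squareMeasure ∂squareMeasure
      ≤ 2 * (1 + periodMeasure univ) * squareMeasure univ * ∫⁻ y, G y ∂shellMeasure η₀ := by
  set κ : Measure ℝ := volume.restrict (Ioc η₀ (η₀ + 1)) with hκ
  have hκ1 : κ univ = 1 := by simp [hκ]
  let H (p : ℝ × ℝ) : ℝ≥0∞ := ∫⁻ s, G (s, p) ∂κ
  let A (η : ℝ) (b : ℝ) : ℝ≥0∞ := ∫⁻ s, G (η, s, b) ∂periodMeasure
  let B (η : ℝ) (a : ℝ) : ℝ≥0∞ := ∫⁻ s, G (η, a, s) ∂periodMeasure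
  have hHm : Measurable H := hG.lintegral_prod_left'
  have hAm : Measurable (fun z : ℝ × ℝ => A z.1 z.2) :=
    Measurable.lintegral_prod_right' (f := fun w : (ℝ × ℝ) × ℝ => G (w.1.1, w.2, w.1.2))
      (hG.comp (by fun_prop))
  have hBm : Measurable (fun z : ℝ × ℝ => B z.1 z.2) :=
    Measurable.lintegral_prod_right' (f := fun w : (ℝ × ℝ) × ℝ => G (w.1.1, w.1.2, w.2))
      (hG.comp (by fun_prop))
  have hd {y : ℝ × ℝ × ℝ} (hy : y ∈ closedBox η₀) : HasFDerivAt W (fderiv ℝ W y) y :=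
    ((hW.contDiffAt (hU.mem_nhds (hbox hy))).differentiableAt one_ne_zero).hasFDerivAt
  have hcont : ContinuousOn (fderiv ℝ W) (closedBox η₀) :=
    (hW.continuousOn_fderiv_of_isOpen hU le_rfl).mono hbox
  have hle {y e : ℝ × ℝ × ℝ} (hy : y ∈ closedBox η₀) (he : ‖e‖ ≤ 1) :
      ‖fderiv ℝ W y e‖ₑ ≤ G y := by
    refine le_trans ?_ (hb y hy)
    rw [← ofReal_norm, ← ofReal_norm]
    refine ENNReal.ofReal_le_ofReal (((fderiv ℝ W y).le_opNorm e).trans ?_)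
    exact mul_le_of_le_one_right (norm_nonneg _) he
  have d1 {η η' a b : ℝ} (h1 : η ∈ Icc η₀ (η₀ + 1)) (h2 : η' ∈ Icc η₀ (η₀ + 1))
      (ha : a ∈ Icc (-Real.pi) Real.pi) (hb' : b ∈ Icc (-Real.pi) Real.pi) :
      ‖W (η, a, b) - W (η', a, b)‖ₑ ≤ H (a, b) := by
    have hm {s : ℝ} (hs : s ∈ Icc η₀ (η₀ + 1)) : (s, a, b) ∈ closedBox η₀ := ⟨hs, ha, hb'⟩
    refine enorm_sub_le_lintegral (φ := fun s => W (s, a, b))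
      (φ' := fun s => fderiv ℝ W (s, a, b) (1, 0, 0)) (fun s hs => ?_) ?_ (fun s hs => ?_) h1 h2
    · exact (hd (hm hs)).comp_hasDerivAt s
        ((hasDerivAt_id s).prodMk ((hasDerivAt_const s a).prodMk (hasDerivAt_const s b)))
    · exact (hcont.comp (Continuous.continuousOn (by fun_prop)) fun s hs => hm hs).clm_apply
        continuousOn_const
    · exact hle (hm hs) (by simp [Prod.norm_def])
  have d2 {η a a' b : ℝ} (h1 : η ∈ Icc η₀ (η₀ + 1)) (h2 : a ∈ Icc (-Real.pi) Real.pi)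
      (ha : a' ∈ Icc (-Real.pi) Real.pi) (hb' : b ∈ Icc (-Real.pi) Real.pi) :
      ‖W (η, a, b) - W (η, a', b)‖ₑ ≤ A η b := by
    have hm {s : ℝ} (hs : s ∈ Icc (-Real.pi) Real.pi) : (η, s, b) ∈ closedBox η₀ :=
      ⟨h1, hs, hb'⟩
    refine enorm_sub_le_lintegral (φ := fun s => W (η, s, b))
      (φ' := fun s => fderiv ℝ W (η, s, b) (0, 1, 0)) (fun s hs => ?_) ?_ (fun s hs => ?_) h2 ha
    · exact (hd (hm hs)).comp_hasDerivAt s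
        ((hasDerivAt_const s η).prodMk ((hasDerivAt_id s).prodMk (hasDerivAt_const s b)))
    · exact (hcont.comp (Continuous.continuousOn (by fun_prop)) fun s hs => hm hs).clm_apply
        continuousOn_const
    · exact hle (hm hs) (by simp [Prod.norm_def])
  have d3 {η a b b' : ℝ} (h1 : η ∈ Icc η₀ (η₀ + 1)) (h2 : a ∈ Icc (-Real.pi) Real.pi)
      (ha : b ∈ Icc (-Real.pi) Real.pi) (hb' : b' ∈ Icc (-Real.pi) Real.pi) :
      ‖W (η, a, b) - W (η, a, b')‖ₑ ≤ B η a := by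
    have hm {s : ℝ} (hs : s ∈ Icc (-Real.pi) Real.pi) : (η, a, s) ∈ closedBox η₀ :=
      ⟨h1, h2, hs⟩
    refine enorm_sub_le_lintegral (φ := fun s => W (η, a, s))
      (φ' := fun s => fderiv ℝ W (η, a, s) (0, 0, 1)) (fun s hs => ?_) ?_ (fun s hs => ?_) ha hb'
    · exact (hd (hm hs)).comp_hasDerivAt s
        ((hasDerivAt_const s η).prodMk ((hasDerivAt_const s a).prodMk (hasDerivAt_id s)))
    · exact (hcont.comp (Continuous.continuousOn (by fun_prop)) fun s hs => hm hs).clm_apply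
        continuousOn_const
    · exact hle (hm hs) (by simp [Prod.norm_def])
  -- The estimate along the path at a fixed height, averaged over the height.
  have hpt {p p' : ℝ × ℝ} (hp : p ∈ Icc (-Real.pi) Real.pi ×ˢ Icc (-Real.pi) Real.pi)
      (hp' : p' ∈ Icc (-Real.pi) Real.pi ×ˢ Icc (-Real.pi) Real.pi) :
      ‖W (η₀, p) - W (η₀, p')‖ₑ
        ≤ H p + (∫⁻ η, A η p.2 ∂κ) + (∫⁻ η, B η p'.1 ∂κ) + H p' := by
    have h0 : η₀ ∈ Icc η₀ (η₀ + 1) := ⟨le_rfl, by linarith⟩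
    have hfix : ∀ η ∈ Ioc η₀ (η₀ + 1),
        ‖W (η₀, p) - W (η₀, p')‖ₑ ≤ H p + A η p.2 + B η p'.1 + H p' := by
      intro η hη
      have hη' := Ioc_subset_Icc_self hη
      have e : W (η₀, p) - W (η₀, p') = (W (η₀, p.1, p.2) - W (η, p.1, p.2))
          + (W (η, p.1, p.2) - W (η, p'.1, p.2)) + (W (η, p'.1, p.2) - W (η, p'.1, p'.2))
          + (W (η, p'.1, p'.2) - W (η₀, p'.1, p'.2)) := by ring
      rw [e]
      refine (enorm_add_le _ _).trans (add_le_add ((enorm_add_le _ _).trans (add_le_add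
        ((enorm_add_le _ _).trans (add_le_add ?_ ?_)) ?_)) ?_)
      · exact d1 h0 hη' hp.1 hp.2
      · exact d2 hη' hp.1 hp'.1 hp.2
      · exact d3 hη' hp'.1 hp.2 hp'.2
      · exact d1 hη' h0 hp'.1 hp'.2
    calc ‖W (η₀, p) - W (η₀, p')‖ₑ = ∫⁻ _, ‖W (η₀, p) - W (η₀, p')‖ₑ ∂κ := by
          rw [lintegral_const, hκ1, mul_one]
      _ ≤ ∫⁻ η, (H p + A η p.2 + B η p'.1 + H p') ∂κ :=
          setLIntegral_mono' measurableSet_Ioc hfix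
      _ = _ := by
          have m1 : Measurable fun η => A η p.2 :=
            hAm.comp (measurable_id.prodMk measurable_const)
          have m2 : Measurable fun η => B η p'.1 :=
            hBm.comp (measurable_id.prodMk measurable_const)
          rw [lintegral_add_right _ measurable_const, lintegral_add_right _ m2,
            lintegral_add_right _ m1, lintegral_const, lintegral_const, hκ1, mul_one, mul_one]
  have hae : ∀ᵐ p ∂squareMeasure, p ∈ Icc (-Real.pi) Real.pi ×ˢ Icc (-Real.pi) Real.pi := by
    rw [squareMeasure_eq_restrict]
    filter_upwards [ae_restrict_mem (measurableSet_Ioc.prod measurableSet_Ioc)] with p hp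
    exact ⟨Ioc_subset_Icc_self hp.1, Ioc_subset_Icc_self hp.2⟩
  set I := ∫⁻ y, G y ∂shellMeasure η₀ with hI
  have hIH : ∫⁻ p, H p ∂squareMeasure = I := (lintegral_prod_symm' _ hG).symm
  have hA1 : Measurable fun b => ∫⁻ η, A η b ∂κ := hAm.lintegral_prod_left'
  have hB1 : Measurable fun a => ∫⁻ η, B η a ∂κ := hBm.lintegral_prod_left'
  have hIA : ∫⁻ b, ∫⁻ η, A η b ∂κ ∂periodMeasure = I := by
    rw [hI, lintegral_prod _ hG.aemeasurable]
    rw [← lintegral_lintegral_swap (f := A) hAm.aemeasurable]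
    refine lintegral_congr fun η => ?_
    exact (lintegral_prod_symm' _ (hG.comp (measurable_prodMk_left (x := η)))).symm
  have hIB : ∫⁻ a, ∫⁻ η, B η a ∂κ ∂periodMeasure = I := by
    rw [hI, lintegral_prod _ hG.aemeasurable]
    rw [← lintegral_lintegral_swap (f := B) hBm.aemeasurable]
    refine lintegral_congr fun η => ?_
    exact (lintegral_prod _ (hG.comp (measurable_prodMk_left (x := η))).aemeasurable).symm
  have mA : Measurable fun p : ℝ × ℝ => ∫⁻ η, A η p.2 ∂κ := hA1.comp measurable_snd
  have mB : Measurable fun p : ℝ × ℝ => ∫⁻ η, B η p.1 ∂κ := hB1.comp measurable_fst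
  have hA2 : ∫⁻ p : ℝ × ℝ, ∫⁻ η, A η p.2 ∂κ ∂squareMeasure = periodMeasure univ * I := by
    rw [lintegral_prod _ mA.aemeasurable]
    simp only [hIA, lintegral_const]
    rw [mul_comm]
  have hB2 : ∫⁻ p : ℝ × ℝ, ∫⁻ η, B η p.1 ∂κ ∂squareMeasure = periodMeasure univ * I := by
    rw [lintegral_prod _ mB.aemeasurable]
    simp only [lintegral_const]
    rw [lintegral_mul_const _ hB1, hIB, mul_comm]
  set V := squareMeasure univ
  set L := periodMeasure univ
  refine le_of_le_of_eq (b := (I + L * I) * V + L * I * V + I * V) ?_ (by ring)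
  calc ∫⁻ p, ∫⁻ p', ‖W (η₀, p) - W (η₀, p')‖ₑ ∂squareMeasure ∂squareMeasure
      ≤ ∫⁻ p, ∫⁻ p', (H p + (∫⁻ η, A η p.2 ∂κ) + (∫⁻ η, B η p'.1 ∂κ) + H p')
          ∂squareMeasure ∂squareMeasure := by
        refine lintegral_mono_ae (hae.mono fun p hp => lintegral_mono_ae (hae.mono fun p' hp' => ?_))
        exact hpt hp hp'
    _ = ∫⁻ p, ((H p + ∫⁻ η, A η p.2 ∂κ) * V + L * I + I) ∂squareMeasure := by
        refine lintegral_congr fun p => ?_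
        rw [lintegral_add_right _ hHm, lintegral_add_right _ mB,
          lintegral_const, hIH, hB2]
    _ = (I + L * I) * V + L * I * V + I * V := by
        rw [lintegral_add_right _ measurable_const, lintegral_add_right _ measurable_const,
          lintegral_mul_const _ (hHm.add mA : Measurable fun p => _ + _), lintegral_add_right _ mA, hIH, hA2,
          lintegral_const, lintegral_const]

/-- Change of variables in the shell: the Jacobian of the toroidal coordinates is bounded below
on the closed box by compactness. -/
lemma exists_lintegral_shell_le {η₀ : ℝ} (hη₀ : 0 < η₀) :
    ∃ C : ℝ≥0∞, C ≠ ⊤ ∧ ∀ g : E3 → ℝ≥0∞, Measurable g →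
      ∫⁻ y, g (tripleMap y) ∂shellMeasure η₀ ≤ C * ∫⁻ x, g x ∂volTorus η₀ := by
  let T : E3 ≃L[ℝ] ℝ × ℝ × ℝ := ContinuousLinearEquiv.ofFinrankEq (by simp)
  let F : E3 → E3 := fun x => tripleMap (T x)
  let F' : E3 → E3 →L[ℝ] E3 := fun x => (fderiv ℝ tripleMap (T x)).comp (T : E3 →L[ℝ] ℝ × ℝ × ℝ)
  let box : Set (ℝ × ℝ × ℝ) :=
    Ioc η₀ (η₀ + 1) ×ˢ Ioc (-Real.pi) Real.pi ×ˢ Ioc (-Real.pi) Real.pi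
  have hboxm : MeasurableSet box :=
    measurableSet_Ioc.prod (measurableSet_Ioc.prod measurableSet_Ioc)
  have hbox : box ⊆ closedBox η₀ :=
    prod_mono Ioc_subset_Icc_self (prod_mono Ioc_subset_Icc_self Ioc_subset_Icc_self)
  have hshell : shellMeasure η₀ = volume.restrict box := by
    rw [Measure.volume_eq_prod, ← Measure.prod_restrict, ← squareMeasure_eq_restrict]
  have hF' {x : E3} (hx : T x ∈ closedBox η₀) : HasFDerivAt F (F' x) x :=
    ((contDiffAt_tripleMap (eta_pos_of_mem_closedBox hη₀ hx)).differentiableAt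
      (by simp)).hasFDerivAt.comp x T.hasFDerivAt
  have hdet {x : E3} (hx : T x ∈ closedBox η₀) : (F' x).det ≠ 0 := by
    have hker : LinearMap.ker (F' x : E3 →ₗ[ℝ] E3) = ⊥ := by
      rw [LinearMap.ker_eq_bot']
      intro v hv
      have := fderiv_tripleMap_eq_zero (eta_pos_of_mem_closedBox hη₀ hx) (v := T v) hv
      simpa using this
    exact ((LinearMap.isUnit_iff_ker_eq_bot _).2 hker).map LinearMap.det |>.ne_zero
  have hcompact : IsCompact (T ⁻¹' closedBox η₀) :=
    T.toHomeomorph.isCompact_preimage.2 (isCompact_closedBox η₀)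
  have hcontdet : ContinuousOn (fun x => |(F' x).det|) (T ⁻¹' closedBox η₀) := by
    have h1 : ContinuousOn (fderiv ℝ tripleMap) {y | 0 < y.1} :=
      contDiffOn_tripleMap.continuousOn_fderiv_of_isOpen isOpen_eta_pos (by simp)
    have h2 : ContinuousOn (fun x => fderiv ℝ tripleMap (T x)) (T ⁻¹' closedBox η₀) :=
      h1.comp T.continuous.continuousOn fun x hx => eta_pos_of_mem_closedBox hη₀ hx
    have h3 : ContinuousOn F' (T ⁻¹' closedBox η₀) := h2.clm_comp continuousOn_const
    exact (ContinuousLinearMap.continuous_det.comp_continuousOn h3).abs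
  obtain ⟨m, hm0, hm⟩ : ∃ m : ℝ, 0 < m ∧ ∀ x, T x ∈ closedBox η₀ → m ≤ |(F' x).det| := by
    have hne : (T ⁻¹' closedBox η₀).Nonempty := by
      have hp := Real.pi_pos
      refine ⟨T.symm (η₀, 0, 0), ?_⟩
      rw [mem_preimage, T.apply_symm_apply]
      exact ⟨⟨le_rfl, by simp⟩, ⟨by simp [hp.le], by simp [hp.le]⟩, ⟨by simp [hp.le], by simp [hp.le]⟩⟩
    obtain ⟨x₀, hx₀, hmin⟩ := hcompact.exists_isMinOn hne hcontdet
    exact ⟨_, abs_pos.2 (hdet hx₀), fun x hx => hmin hx⟩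
  have hTme : Measurable T := T.continuous.measurable
  -- The constant relating the two Haar measures does not matter, so `T` may be any isomorphism.
  have hHaar : (Measure.map T (volume : Measure E3)).IsAddHaarMeasure :=
    T.isAddHaarMeasure_map volume
  have : (volume : Measure (ℝ × ℝ)).IsAddHaarMeasure := by
    rw [Measure.volume_eq_prod]; infer_instance
  have : (volume : Measure (ℝ × ℝ × ℝ)).IsAddHaarMeasure := by
    rw [Measure.volume_eq_prod]; infer_instance
  set c := (volume : Measure (ℝ × ℝ × ℝ)).addHaarScalarFactor (Measure.map T (volume : Measure E3))
  have hvol : (volume : Measure (ℝ × ℝ × ℝ)) = c • Measure.map T (volume : Measure E3) :=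
    Measure.isAddLeftInvariant_eq_smul _ _
  have himg : F '' (T ⁻¹' box) ⊆ solidTorus η₀ := by
    rintro _ ⟨x, hx, rfl⟩
    exact Or.inl ⟨_, _, _, hx.1.1, rfl⟩
  have hinj : InjOn F (T ⁻¹' box) := by
    intro x hx x' hx' hxx
    have hmem {z : E3} (hz : z ∈ T ⁻¹' box) : T z ∈ {y : ℝ × ℝ × ℝ |
        0 < y.1 ∧ y.2.1 ∈ Ioc (-Real.pi) Real.pi ∧ y.2.2 ∈ Ioc (-Real.pi) Real.pi} :=
      ⟨hη₀.trans hz.1.1, hz.2.1, hz.2.2⟩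
    exact T.injective (injOn_tripleMap (hmem hx) (hmem hx') hxx)
  refine ⟨c * ENNReal.ofReal m⁻¹, ENNReal.mul_ne_top (by simp) ENNReal.ofReal_ne_top,
    fun g hg => ?_⟩
  have hFm : Measurable F := measurable_tripleMap.comp hTme
  calc ∫⁻ y, g (tripleMap y) ∂shellMeasure η₀
      = c * ∫⁻ x in T ⁻¹' box, g (F x) := by
        rw [hshell, hvol, Measure.restrict_smul, lintegral_smul_measure,
          setLIntegral_map (f := fun y => g (tripleMap y)) hboxm (hg.comp measurable_tripleMap)
            hTme]
        rfl
    _ ≤ c * ∫⁻ x in T ⁻¹' box,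
          ENNReal.ofReal m⁻¹ * (ENNReal.ofReal |(F' x).det| * g (F x)) := by
        refine mul_le_mul' le_rfl (setLIntegral_mono' (hTme hboxm) fun x hx => ?_)
        rw [← mul_assoc, ← ENNReal.ofReal_mul (by positivity)]
        refine le_mul_of_one_le_left zero_le ?_
        rw [ENNReal.one_le_ofReal, ← div_eq_inv_mul, one_le_div hm0]
        exact hm x (hbox hx)
    _ = c * ENNReal.ofReal m⁻¹ * ∫⁻ x in F '' (T ⁻¹' box), g x := by
        rw [lintegral_const_mul' _ _ ENNReal.ofReal_ne_top, mul_assoc,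
          lintegral_image_eq_lintegral_abs_det_fderiv_mul volume (hTme hboxm)
            (fun x hx => (hF' (hbox hx)).hasFDerivWithinAt) hinj]
    _ ≤ c * ENNReal.ofReal m⁻¹ * ∫⁻ x, g x ∂volTorus η₀ := by
        gcongr
        exact Measure.restrict_mono himg le_rfl

/-! ### Functions with vanishing gradient -/

/-- The oscillation on `∂Ω` of a smooth function is controlled by its gradient in `Ω`. -/
lemma exists_lintegral_oscillation_le {η₀ : ℝ} (hη₀ : 0 < η₀) :
    ∃ C : ℝ≥0∞, C ≠ ⊤ ∧ ∀ w : E3 → ℝ, ContDiff ℝ ∞ w →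
      ∫⁻ p : ℝ × ℝ, ∫⁻ p' : ℝ × ℝ, ‖w (point η₀ p.1 p.2) - w (point η₀ p'.1 p'.2)‖ₑ
        ∂squareMeasure ∂squareMeasure ≤ C * ∫⁻ x, ‖gradient w x‖ₑ ∂volTorus η₀ := by
  have hcont : ContinuousOn (fderiv ℝ tripleMap) (closedBox η₀) :=
    (contDiffOn_tripleMap.continuousOn_fderiv_of_isOpen isOpen_eta_pos (by simp)).mono
      fun y hy => eta_pos_of_mem_closedBox hη₀ hy
  obtain ⟨M, hM⟩ := (isCompact_closedBox η₀).exists_bound_of_continuousOn hcont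
  obtain ⟨C, hC, hCle⟩ := exists_lintegral_shell_le hη₀
  refine ⟨2 * (1 + periodMeasure univ) * squareMeasure univ * (ENNReal.ofReal M * C), ?_,
    fun w hw => ?_⟩
  · refine ENNReal.mul_ne_top (ENNReal.mul_ne_top (ENNReal.mul_ne_top (by simp) ?_) ?_)
      (ENNReal.mul_ne_top ENNReal.ofReal_ne_top hC)
    · exact ENNReal.add_ne_top.2 ⟨by simp, measure_ne_top _ _⟩
    · exact measure_ne_top _ _
  have hgc : Continuous (gradient w) :=
    (InnerProductSpace.toDual ℝ E3).symm.continuous.comp (hw.continuous_fderiv (by simp))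
  have hgm : Measurable fun x => ‖gradient w x‖ₑ := hgc.measurable.enorm
  have hW : ContDiffOn ℝ 1 (w ∘ tripleMap) {y | 0 < y.1} :=
    ((hw.comp_contDiffOn contDiffOn_tripleMap).of_le (by simp))
  have h := lintegral_oscillation_le (η₀ := η₀) isOpen_eta_pos hW
    (fun y hy => eta_pos_of_mem_closedBox hη₀ hy)
    (G := fun y => ENNReal.ofReal M * ‖gradient w (tripleMap y)‖ₑ)
    ((hgm.comp measurable_tripleMap).const_mul _) (fun y hy => ?_)
  · refine h.trans ?_
    have hgm' : Measurable fun y => ‖gradient w (tripleMap y)‖ₑ := hgm.comp measurable_tripleMap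
    rw [lintegral_const_mul _ hgm', mul_assoc _ (_ * C), mul_assoc _ C]
    gcongr
    exact hCle _ hgm
  · have hd := ((contDiffAt_tripleMap (eta_pos_of_mem_closedBox hη₀ hy)).differentiableAt
      (by simp))
    rw [fderiv_comp y (hw.differentiable (by simp) _) hd]
    have hn : ‖gradient w (tripleMap y)‖ = ‖fderiv ℝ w (tripleMap y)‖ :=
      (InnerProductSpace.toDual ℝ E3).symm.norm_map _
    rw [← ofReal_norm, ← ofReal_norm, hn, ← ENNReal.ofReal_mul ((norm_nonneg _).trans (hM y hy))]
    refine ENNReal.ofReal_le_ofReal ((ContinuousLinearMap.opNorm_comp_le _ _).trans ?_)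
    rw [mul_comm]
    gcongr
    exact hM y hy

lemma lintegral_enorm_Lp_le {α E : Type*} [MeasurableSpace α] {μ : Measure α}
    [NormedAddCommGroup E] (f : Lp E 2 μ) :
    ∫⁻ x, ‖f x‖ₑ ∂μ ≤ ‖f‖ₑ * μ univ ^ (1 / 2 : ℝ) := by
  rw [← eLpNorm_one_eq_lintegral_enorm, Lp.enorm_def]
  refine (eLpNorm_le_eLpNorm_mul_rpow_measure_univ (q := 2) (by norm_num)
    (Lp.aestronglyMeasurable f)).trans_eq ?_
  norm_num

/-- A function in `H¹(Ω)` with vanishing gradient has constant boundary values. -/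
lemma exists_ae_eq_const_of_isTrace {η₀ : ℝ} (hη₀ : 0 < η₀) {u : H1 η₀} (hu : u.1.2 = 0)
    {g : L2Bdry η₀} (hg : IsTrace u g) : ∃ k : ℝ, g =ᵐ[surfaceMeasure η₀] fun _ => k := by
  have := isFiniteMeasure_surfaceMeasure hη₀
  have := isFiniteMeasure_volTorus hη₀
  obtain ⟨C₁, hC₁, hC₁le⟩ := exists_lintegral_oscillation_le hη₀
  obtain ⟨C₂, -, hC₂, hC₂le⟩ := exists_squareMeasure_le hη₀
  obtain ⟨C₃, -, hC₃, hC₃le⟩ := exists_surfaceParam_le hη₀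
  set V := squareMeasure univ
  let P (p : ℝ × ℝ) : E3 := point η₀ p.1 p.2
  have hP : Measurable P := measurable_point η₀
  have hgm : Measurable g := (Lp.stronglyMeasurable g).measurable
  have hgP : Measurable fun p => g (P p) := hgm.comp hP
  set K := 2 * V * (C₂ * surfaceMeasure η₀ univ ^ (1 / 2 : ℝ))
    + C₁ * volTorus η₀ univ ^ (1 / 2 : ℝ) with hK
  have hKtop : K ≠ ⊤ := by
    refine ENNReal.add_ne_top.2 ⟨ENNReal.mul_ne_top (ENNReal.mul_ne_top (by simp)
      (measure_ne_top _ _)) (ENNReal.mul_ne_top hC₂ ?_), ENNReal.mul_ne_top hC₁ ?_⟩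
    · exact ENNReal.rpow_ne_top_of_nonneg (by norm_num) (measure_ne_top _ _)
    · exact ENNReal.rpow_ne_top_of_nonneg (by norm_num) (measure_ne_top _ _)
  have hosc : ∀ ε : ℝ, 0 < ε →
      ∫⁻ p, ∫⁻ p', ‖g (P p) - g (P p')‖ₑ ∂squareMeasure ∂squareMeasure
        ≤ K * ENNReal.ofReal ε := by
    intro ε hε
    -- The trace is defined through the closure of the graph of smooth functions.
    obtain ⟨p₀, ⟨w, hw, -, hw2, hw3⟩, hdist⟩ := Metric.mem_closure_iff.1 hg ε hε
    have hwP : Measurable fun p => w (P p) := hw.continuous.measurable.comp hP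
    have hgrad : ‖p₀.1.2‖ₑ ≤ ENNReal.ofReal ε := by
      rw [← ofReal_norm]
      refine ENNReal.ofReal_le_ofReal (le_trans ?_ hdist.le)
      have h1 : dist (u : L2 η₀ × L2V η₀).2 p₀.1.2 ≤ dist ((u : L2 η₀ × L2V η₀), g) p₀ := by
        rw [Prod.dist_eq, Prod.dist_eq]
        exact (le_max_right _ _).trans (le_max_left _ _)
      rwa [hu, dist_zero_left] at h1
    have hbd : ‖g - p₀.2‖ₑ ≤ ENNReal.ofReal ε := by
      rw [← ofReal_norm]
      refine ENNReal.ofReal_le_ofReal (le_trans ?_ hdist.le)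
      rw [← dist_eq_norm, Prod.dist_eq]
      exact le_max_right _ _
    have h1 : ∫⁻ p, ‖g (P p) - w (P p)‖ₑ ∂squareMeasure
        ≤ C₂ * surfaceMeasure η₀ univ ^ (1 / 2 : ℝ) * ENNReal.ofReal ε := by
      calc ∫⁻ p, ‖g (P p) - w (P p)‖ₑ ∂squareMeasure
          ≤ ∫⁻ p, ‖g (P p) - w (P p)‖ₑ ∂(C₂ • surfaceParam η₀) := lintegral_mono' hC₂le le_rfl
        _ = C₂ * ∫⁻ x, ‖g x - w x‖ₑ ∂surfaceMeasure η₀ := by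
          rw [lintegral_smul_measure,
            lintegral_surfaceMeasure (F := fun x => ‖g x - w x‖ₑ)
              (hgm.sub hw.continuous.measurable).enorm]
          rfl
        _ = C₂ * ∫⁻ x, ‖(g - p₀.2) x‖ₑ ∂surfaceMeasure η₀ := by
          congr 1
          refine lintegral_congr_ae ?_
          filter_upwards [hw3, Lp.coeFn_sub g p₀.2] with x h2 h3
          rw [h3, Pi.sub_apply, h2]
        _ ≤ C₂ * (‖g - p₀.2‖ₑ * surfaceMeasure η₀ univ ^ (1 / 2 : ℝ)) := by
          gcongr; exact lintegral_enorm_Lp_le _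
        _ ≤ C₂ * (ENNReal.ofReal ε * surfaceMeasure η₀ univ ^ (1 / 2 : ℝ)) := by gcongr
        _ = _ := by ring
    have h2 : ∫⁻ p, ∫⁻ p', ‖w (P p) - w (P p')‖ₑ ∂squareMeasure ∂squareMeasure
        ≤ C₁ * volTorus η₀ univ ^ (1 / 2 : ℝ) * ENNReal.ofReal ε := by
      calc _ ≤ C₁ * ∫⁻ x, ‖gradient w x‖ₑ ∂volTorus η₀ := hC₁le w hw
        _ = C₁ * ∫⁻ x, ‖p₀.1.2 x‖ₑ ∂volTorus η₀ := by
          congr 1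
          refine lintegral_congr_ae ?_
          filter_upwards [hw2] with x h2
          rw [h2]
        _ ≤ C₁ * (‖p₀.1.2‖ₑ * volTorus η₀ univ ^ (1 / 2 : ℝ)) := by
          gcongr; exact lintegral_enorm_Lp_le _
        _ ≤ C₁ * (ENNReal.ofReal ε * volTorus η₀ univ ^ (1 / 2 : ℝ)) := by gcongr
        _ = _ := by ring
    have hm : Measurable fun p => ‖g (P p) - w (P p)‖ₑ := (hgP.sub hwP).enorm
    have hm2 : Measurable fun z : (ℝ × ℝ) × (ℝ × ℝ) => ‖w (P z.1) - w (P z.2)‖ₑ :=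
      ((hwP.comp measurable_fst).sub (hwP.comp measurable_snd)).enorm
    set δ := ∫⁻ p, ‖g (P p) - w (P p)‖ₑ ∂squareMeasure
    calc ∫⁻ p, ∫⁻ p', ‖g (P p) - g (P p')‖ₑ ∂squareMeasure ∂squareMeasure
        ≤ ∫⁻ p, ∫⁻ p', (‖g (P p) - w (P p)‖ₑ + ‖w (P p) - w (P p')‖ₑ + ‖g (P p') - w (P p')‖ₑ)
            ∂squareMeasure ∂squareMeasure := by
          refine lintegral_mono fun p => lintegral_mono fun p' => ?_
          have e : g (P p) - g (P p') = (g (P p) - w (P p)) + (w (P p) - w (P p'))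
              + (w (P p') - g (P p')) := by ring
          rw [e, ← enorm_neg (g (P p') - w (P p')), neg_sub]
          exact (enorm_add_le _ _).trans (add_le_add (enorm_add_le _ _) le_rfl)
      _ = ∫⁻ p, (‖g (P p) - w (P p)‖ₑ * V + (∫⁻ p', ‖w (P p) - w (P p')‖ₑ ∂squareMeasure) + δ)
            ∂squareMeasure := by
          refine lintegral_congr fun p => ?_
          have hm3 : Measurable fun p' => ‖w (P p) - w (P p')‖ₑ := (measurable_const.sub hwP).enorm
          rw [lintegral_add_right _ hm, lintegral_add_right _ hm3, lintegral_const]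
      _ = δ * V + (∫⁻ p, ∫⁻ p', ‖w (P p) - w (P p')‖ₑ ∂squareMeasure ∂squareMeasure) + δ * V := by
          have hm4 : Measurable fun p => ∫⁻ p', ‖w (P p) - w (P p')‖ₑ ∂squareMeasure :=
            hm2.lintegral_prod_right'
          rw [lintegral_add_right _ measurable_const, lintegral_add_right _ hm4,
            lintegral_mul_const _ hm, lintegral_const]
      _ ≤ (C₂ * surfaceMeasure η₀ univ ^ (1 / 2 : ℝ) * ENNReal.ofReal ε) * V
          + (C₁ * volTorus η₀ univ ^ (1 / 2 : ℝ) * ENNReal.ofReal ε)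
          + (C₂ * surfaceMeasure η₀ univ ^ (1 / 2 : ℝ) * ENNReal.ofReal ε) * V := by
          gcongr
      _ = K * ENNReal.ofReal ε := by rw [hK]; ring
  have hzero : ∫⁻ p, ∫⁻ p', ‖g (P p) - g (P p')‖ₑ ∂squareMeasure ∂squareMeasure = 0 := by
    refine le_antisymm ?_ zero_le
    have hlim : Tendsto (fun ε : ℝ => K * ENNReal.ofReal ε) (𝓝[>] 0) (𝓝 0) := by
      have h1 : Tendsto (fun ε : ℝ => ENNReal.ofReal ε) (𝓝[>] 0) (𝓝 0) := by
        have := (ENNReal.continuous_ofReal.tendsto 0).mono_left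
          (nhdsWithin_le_nhds (s := Ioi (0 : ℝ)))
        rwa [ENNReal.ofReal_zero] at this
      have := ENNReal.Tendsto.const_mul h1 (Or.inr hKtop)
      rwa [mul_zero] at this
    exact ge_of_tendsto hlim (eventually_mem_nhdsWithin.mono hosc)
  have hm : Measurable fun z : (ℝ × ℝ) × (ℝ × ℝ) => ‖g (P z.1) - g (P z.2)‖ₑ :=
    ((hgP.comp measurable_fst).sub (hgP.comp measurable_snd)).enorm
  rw [lintegral_eq_zero_iff hm.lintegral_prod_right'] at hzero
  have hne : (ae squareMeasure).NeBot := by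
    rw [ae_neBot]
    exact squareMeasure_ne_zero
  obtain ⟨p, hp⟩ := hzero.exists
  refine ⟨g (P p), ?_⟩
  have hmp : Measurable fun p' => ‖g (P p) - g (P p')‖ₑ := (measurable_const.sub hgP).enorm
  have hp' := (lintegral_eq_zero_iff hmp).1 hp
  have hac : surfaceParam η₀ ≪ squareMeasure :=
    (Measure.absolutelyContinuous_of_le hC₃le).trans Measure.smul_absolutelyContinuous
  refine (ae_surfaceMeasure_iff (measurableSet_eq_fun hgm measurable_const)).2 ?_
  filter_upwards [hac.ae_le hp'] with p' h
  simp only [Pi.zero_apply, enorm_eq_zero, sub_eq_zero] at h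
  exact h.symm

/-! ### Expansions and the Dirichlet-to-Neumann map -/

/-- Every element of `H^{1/2}(∂Ω)` has a toroidal expansion, whose coefficients are the Fourier
coefficients of `f(θ, φ) (cosh η₀ - cos θ)^(-1/2)`. -/
lemma hasExpansion_fourier {η₀ : ℝ} (hη₀ : 0 < η₀) (f : HHalf η₀) :
    HasExpansion f fun i => (∫ p : ℝ × ℝ, (f : L2Bdry η₀) (point η₀ p.1 p.2)
      / Real.sqrt (Real.cosh η₀ - Real.cos p.1) * PhiPhi i p ∂squareMeasure) / phiPhiNormSq i := by
  have h1 : 0 < Real.cosh η₀ - 1 := by linarith [Real.one_lt_cosh.2 hη₀.ne']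
  obtain ⟨C₂, -, hC₂, hC₂le⟩ := exists_squareMeasure_le hη₀
  obtain ⟨C₃, hC₃0, hC₃, hC₃le⟩ := exists_surfaceParam_le hη₀
  let ρ (p : ℝ × ℝ) : ℝ := Real.sqrt (Real.cosh η₀ - Real.cos p.1)
  have hρ (p : ℝ × ℝ) : 0 < ρ p := Real.sqrt_pos.2 (cosh_sub_cos_pos hη₀ p.1)
  let F (p : ℝ × ℝ) : ℝ := (f : L2Bdry η₀) (point η₀ p.1 p.2)
  have hF : MemLp F 2 squareMeasure := by
    have h2 : MemLp F 2 (surfaceParam η₀) :=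
      (Lp.memLp (f : L2Bdry η₀)).comp_of_map (measurable_point η₀).aemeasurable
    exact h2.of_measure_le_smul hC₂ hC₂le
  have hg : MemLp (fun p => F p / ρ p) 2 squareMeasure := by
    refine hF.of_le_mul (c := (Real.sqrt (Real.cosh η₀ - 1))⁻¹) ?_ (ae_of_all _ fun p => ?_)
    · have hc : Continuous fun p => (ρ p)⁻¹ :=
        Continuous.inv₀ (by fun_prop) fun p => (hρ p).ne'
      simp only [div_eq_mul_inv]
      exact hF.aestronglyMeasurable.mul hc.aestronglyMeasurable
    · rw [norm_div, div_eq_inv_mul, Real.norm_of_nonneg (hρ p).le]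
      have : 0 < Real.sqrt (Real.cosh η₀ - 1) := Real.sqrt_pos.2 h1
      gcongr
      exact Real.sqrt_le_sqrt (by linarith [Real.cos_le_one p.1])
  have hlim := tendsto_fourier_series hg
  have hbd : ∀ H : ℝ × ℝ → ℝ, eLpNorm (fun p => ρ p * H p) 2 (surfaceParam η₀)
      ≤ C₃ ^ (1 / (2 : ℝ≥0∞)).toReal * ENNReal.ofReal (Real.sqrt (Real.cosh η₀ + 1))
        * eLpNorm H 2 squareMeasure := by
    intro H
    refine (eLpNorm_mono_measure _ hC₃le).trans ?_
    rw [eLpNorm_smul_measure_of_ne_zero hC₃0, smul_eq_mul, mul_assoc]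
    gcongr
    refine eLpNorm_le_mul_eLpNorm_of_ae_le_mul (ae_of_all _ fun p => ?_) 2
    rw [norm_mul, Real.norm_of_nonneg (hρ p).le]
    gcongr
    exact Real.sqrt_le_sqrt (by linarith [Real.neg_one_le_cos p.1])
  have hK : C₃ ^ (1 / (2 : ℝ≥0∞)).toReal * ENNReal.ofReal (Real.sqrt (Real.cosh η₀ + 1)) ≠ ⊤ :=
    ENNReal.mul_ne_top (ENNReal.rpow_ne_top_of_nonneg (by positivity) hC₃) ENNReal.ofReal_ne_top
  have hlim' := ENNReal.Tendsto.const_mul hlim (Or.inr hK)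
  rw [mul_zero] at hlim'
  refine tendsto_of_tendsto_of_tendsto_of_le_of_le tendsto_const_nhds hlim' (fun s => zero_le)
    fun s => ?_
  refine le_trans (le_of_eq ?_) (hbd _)
  congr 1
  ext p
  rw [mul_sub, Finset.mul_sum, mul_div_cancel₀ _ (hρ p).ne']
  congr 1
  refine Finset.sum_congr rfl fun i _ => ?_
  simp only [bdryHarmonic, PhiPhi, F, ρ]
  ring

lemma HasExpansion.add {η₀ : ℝ} {f g : HHalf η₀} {a b : Index → ℝ} (hf : HasExpansion f a)
    (hg : HasExpansion g b) : HasExpansion (f + g) fun i => a i + b i := by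
  have hsum := Tendsto.add hf hg
  rw [add_zero] at hsum
  refine tendsto_of_tendsto_of_tendsto_of_le_of_le tendsto_const_nhds hsum (fun s => zero_le)
    fun s => ?_
  have hmeas (k : HHalf η₀) (c : Index → ℝ) : AEStronglyMeasurable (fun p : ℝ × ℝ =>
      (k : L2Bdry η₀) (point η₀ p.1 p.2) - ∑ i ∈ s, c i * bdryHarmonic η₀ i p)
      (surfaceParam η₀) := by
    refine AEStronglyMeasurable.sub ?_ (Continuous.aestronglyMeasurable ?_)
    · exact ((Lp.stronglyMeasurable (k : L2Bdry η₀)).comp_measurable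
        (measurable_point η₀)).aestronglyMeasurable
    · refine continuous_finsetSum _ fun i _ => continuous_const.mul ?_
      refine Continuous.mul (Continuous.mul (by fun_prop) ?_) ?_
      · exact (continuous_Phi _ _).comp continuous_fst
      · exact (continuous_Phi _ _).comp continuous_snd
  refine le_trans (le_of_eq (eLpNorm_congr_ae ?_))
    (eLpNorm_add_le (hmeas f a) (hmeas g b) (by norm_num))
  have hadd : ∀ᵐ x ∂surfaceMeasure η₀, ((f + g : HHalf η₀) : L2Bdry η₀) x
      = (f : L2Bdry η₀) x + (g : L2Bdry η₀) x := Lp.coeFn_add _ _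
  filter_upwards [ae_of_ae_map (measurable_point η₀).aemeasurable hadd] with p hp
  simp only [Pi.add_apply]
  rw [hp]
  simp only [add_mul, Finset.sum_add_distrib]
  ring

lemma integral_Phi (n : ℕ) (ν : ℤˣ) (hn : ¬ (n = 0 ∧ ν = -1)) :
    ∫ x, Phi n ν x ∂periodMeasure = if n = 0 ∧ ν = 1 then 2 * Real.pi else 0 := by
  have h := integral_Phi_mul_Phi hn 0 1
  simp only [Phi_one 0, Nat.cast_zero, zero_mul, Real.cos_zero, mul_one] at h
  rw [h]
  split_ifs with h0
  · simp [phiNormSq, h0.1]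
  · rfl

/-- The Fourier coefficients of `(cosh η₀ - cos θ)^(-1/2)` over a full period: the function is
even, so those with the sines vanish and the others are twice the integrals over `(0, π)`. -/
lemma integral_inv_sqrt_mul_Phi {η₀ : ℝ} (hη₀ : 0 < η₀) (n : ℕ) (ν : ℤˣ) :
    ∫ x, (Real.sqrt (Real.cosh η₀ - Real.cos x))⁻¹ * Phi n ν x ∂periodMeasure
      = if ν = 1 then 2 * (Real.sqrt 2 * q η₀ n 0) else 0 := by
  rw [integral_periodMeasure]
  have hcont : Continuous fun x => (Real.sqrt (Real.cosh η₀ - Real.cos x))⁻¹ * Phi n ν x :=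
    (Continuous.inv₀ (by fun_prop)
      fun x => (Real.sqrt_pos.2 (cosh_sub_cos_pos hη₀ x)).ne').mul (continuous_Phi n ν)
  have hneg := intervalIntegral.integral_comp_neg (a := 0) (b := Real.pi)
    (fun x => (Real.sqrt (Real.cosh η₀ - Real.cos x))⁻¹ * Phi n ν x)
  rw [← intervalIntegral.integral_add_adjacent_intervals (b := 0)
    (hcont.intervalIntegrable _ _) (hcont.intervalIntegrable _ _), ← neg_zero, ← hneg, neg_zero]
  rcases Int.units_eq_one_or ν with rfl | rfl
  · rw [if_pos rfl, ← heineCos_eq_q hη₀]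
    simp only [Phi_one, mul_neg, Real.cos_neg]
    rw [← two_mul, heineCos]
    simp only [div_eq_inv_mul]
  · rw [if_neg (by decide)]
    simp only [Phi_neg_one, mul_neg, Real.cos_neg, Real.sin_neg]
    rw [intervalIntegral.integral_neg]
    ring

/-- The constant function `k` as an element of `H¹(Ω)`. -/
noncomputable def constH1 {η₀ : ℝ} (hη₀ : 0 < η₀) (k : ℝ) : H1 η₀ :=
  haveI := isFiniteMeasure_volTorus hη₀
  ⟨(Lp.const 2 (volTorus η₀) k, 0), by
    intro ψ hψ e
    have h1 : ∫ x in solidTorus η₀, Lp.const 2 (volTorus η₀) k x * fderiv ℝ ψ x e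
        = ∫ x in solidTorus η₀, k * fderiv ℝ ψ x e := by
      refine integral_congr_ae ?_
      filter_upwards [Lp.coeFn_const 2 (volTorus η₀) k] with x hx
      rw [hx, Function.const_apply]
    have h2 : ∫ x in solidTorus η₀, ⟪e, (0 : L2V η₀) x⟫_ℝ * ψ x = 0 := by
      refine integral_eq_zero_of_ae ?_
      filter_upwards [Lp.coeFn_zero E3 2 (volTorus η₀)] with x hx
      rw [hx, Pi.zero_apply, inner_zero_right, zero_mul, Pi.zero_apply]
    have h3 : ∫ x in solidTorus η₀, k * fderiv ℝ ψ x e = ∫ x, k * fderiv ℝ ψ x e := by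
      refine setIntegral_eq_integral_of_forall_compl_eq_zero fun x hx => ?_
      have : fderiv ℝ ψ x = 0 := by
        by_contra hne
        exact hx (hψ.2.2 (support_fderiv_subset ℝ (Function.mem_support.2 hne)))
      rw [this]; simp
    have hi1 : Integrable (fun x => fderiv ℝ ψ x e) :=
      ((hψ.1.continuous_fderiv (by simp)).clm_apply
        continuous_const).integrable_of_hasCompactSupport (hψ.2.1.fderiv_apply (𝕜 := ℝ) e)
    have hi0 : Integrable ψ := hψ.1.continuous.integrable_of_hasCompactSupport hψ.2.1
    have h4 : ∫ x, k * fderiv ℝ ψ x e = 0 := by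
      rw [integral_mul_fderiv_eq_neg_fderiv_mul_of_integrable (f := fun _ => k)]
      · simp
      · simp
      · exact hi1.const_mul k
      · exact hi0.const_mul k
      · exact fun x _ => differentiableAt_const k
      · exact fun x _ => hψ.1.differentiable (by simp) x
    show ∫ x in solidTorus η₀, Lp.const 2 (volTorus η₀) k x * fderiv ℝ ψ x e
      = - ∫ x in solidTorus η₀, ⟪e, (0 : L2V η₀) x⟫_ℝ * ψ x
    rw [h1, h2, h3, h4, neg_zero]⟩

lemma exists_isTrace_constH1 {η₀ : ℝ} (hη₀ : 0 < η₀) (k : ℝ) : ∃ g : HHalf η₀,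
    IsTrace (constH1 hη₀ k) g ∧ (g : L2Bdry η₀) =ᵐ[surfaceMeasure η₀] fun _ => k := by
  have := isFiniteMeasure_volTorus hη₀
  have := isFiniteMeasure_surfaceMeasure hη₀
  have h : IsTrace (constH1 hη₀ k) (Lp.const 2 (surfaceMeasure η₀) k) := by
    refine subset_closure ⟨fun _ => k, contDiff_const, Lp.coeFn_const 2 (volTorus η₀) k, ?_,
      Lp.coeFn_const 2 (surfaceMeasure η₀) k⟩
    filter_upwards [Lp.coeFn_zero E3 2 (volTorus η₀)] with x hx
    rw [gradient_fun_const]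
    exact hx
  exact ⟨⟨_, _, h⟩, h, Lp.coeFn_const 2 (surfaceMeasure η₀) k⟩

/-- The expansion of a constant function, by Heine's formula. -/
lemma hasExpansion_const {η₀ : ℝ} (hη₀ : 0 < η₀) {k : ℝ} {g : HHalf η₀}
    (hg : (g : L2Bdry η₀) =ᵐ[surfaceMeasure η₀] fun _ => k) :
    HasExpansion g fun i => if i.m = 0 ∧ i.ν = 1 ∧ i.μ = 1 then
      neumannFactor i.n * (Real.sqrt 2 / Real.pi) * q η₀ i.n 0 * k else 0 := by
  have hpi := Real.pi_pos
  obtain ⟨C₂, -, -, hC₂le⟩ := exists_squareMeasure_le hη₀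
  have hac : squareMeasure ≪ surfaceParam η₀ :=
    (Measure.absolutelyContinuous_of_le hC₂le).trans Measure.smul_absolutelyContinuous
  have hgP : ∀ᵐ p : ℝ × ℝ ∂squareMeasure, (g : L2Bdry η₀) (point η₀ p.1 p.2) = k :=
    hac.ae_le (ae_of_ae_map (measurable_point η₀).aemeasurable hg)
  convert hasExpansion_fourier hη₀ g using 2 with i
  have e : ∫ p : ℝ × ℝ, (g : L2Bdry η₀) (point η₀ p.1 p.2)
      / Real.sqrt (Real.cosh η₀ - Real.cos p.1) * PhiPhi i p ∂squareMeasure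
      = k * ((∫ x, (Real.sqrt (Real.cosh η₀ - Real.cos x))⁻¹ * Phi i.n i.ν x ∂periodMeasure)
        * ∫ x, Phi i.m i.μ x ∂periodMeasure) := by
    rw [← integral_prod_mul, ← integral_const_mul]
    refine integral_congr_ae ?_
    filter_upwards [hgP] with p hp
    rw [hp, PhiPhi]; ring
  rw [e, integral_inv_sqrt_mul_Phi hη₀, integral_Phi _ _ i.hm]
  by_cases h1 : i.m = 0 ∧ i.ν = 1 ∧ i.μ = 1
  · rw [if_pos h1, if_pos h1.2.1, if_pos ⟨h1.1, h1.2.2⟩]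
    unfold phiPhiNormSq phiNormSq neumannFactor
    rw [h1.1, if_pos (rfl : (0 : ℕ) = 0)]
    split_ifs <;> field_simp
  · rw [if_neg h1]
    by_cases h2 : i.ν = 1
    · rw [if_neg (c := i.m = 0 ∧ i.μ = 1) fun h3 => h1 ⟨h3.1, h2, h3.2⟩]
      simp
    · rw [if_neg h2]
      simp

lemma bdryIntegral_add {η₀ : ℝ} (hη₀ : 0 < η₀) (f g : HHalf η₀) :
    bdryIntegral (f + g) = bdryIntegral f + bdryIntegral g := by
  have := isFiniteMeasure_surfaceMeasure hη₀
  have hi (f : HHalf η₀) : Integrable (f : L2Bdry η₀) (surfaceMeasure η₀) :=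
    (Lp.memLp _).integrable (by norm_num)
  unfold bdryIntegral
  rw [← integral_add (hi f) (hi g)]
  exact integral_congr_ae (Lp.coeFn_add _ _)

lemma bdryIntegral_of_ae_eq_const {η₀ k : ℝ} {g : HHalf η₀}
    (hg : (g : L2Bdry η₀) =ᵐ[surfaceMeasure η₀] fun _ => k) : bdryIntegral g = area η₀ * k := by
  unfold bdryIntegral area
  rw [integral_congr_ae hg, integral_const, smul_eq_mul]

/-- Constants lie in the kernel of the Dirichlet-to-Neumann map. -/
lemma DirichletToNeumann.add_const {η₀ k : ℝ} (hη₀ : 0 < η₀) {f g : HHalf η₀} {h : HMinusHalf η₀}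
    (hf : DirichletToNeumann f h) (hg : IsTrace (constH1 hη₀ k) g) :
    DirichletToNeumann (f + g) h := by
  obtain ⟨u, hu, hut, hun⟩ := hf
  have hgrad : (u + constH1 hη₀ k).1.2 = u.1.2 := add_zero u.1.2
  refine ⟨u + constH1 hη₀ k, ?_, Submodule.add_mem _ hut hg, ?_⟩
  · intro ψ hψ
    rw [hgrad]
    exact hu ψ hψ
  · intro v g hv
    rw [hgrad]
    exact hun v g hv

/-- The kernel of the Dirichlet-to-Neumann map consists of constants: by the weak formulation the
difference of two harmonic functions with equal normal derivatives has zero Dirichlet energy. -/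
lemma DirichletToNeumann.exists_sub_ae_eq_const {η₀ : ℝ} (hη₀ : 0 < η₀) {f g : HHalf η₀}
    {h : HMinusHalf η₀} (hf : DirichletToNeumann f h) (hg : DirichletToNeumann g h) :
    ∃ k : ℝ, ((f - g : HHalf η₀) : L2Bdry η₀) =ᵐ[surfaceMeasure η₀] fun _ => k := by
  obtain ⟨u, -, hut, hun⟩ := hf
  obtain ⟨v, -, hvt, hvn⟩ := hg
  have ht : IsTrace (u - v) ((f - g : HHalf η₀) : L2Bdry η₀) := Submodule.sub_mem _ hut hvt
  refine exists_ae_eq_const_of_isTrace hη₀ (u := u - v) ?_ ht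
  have h1 : ⟪u.1.2, (u - v).1.2⟫_ℝ = ⟪v.1.2, (u - v).1.2⟫_ℝ := by
    rw [L2.inner_def, L2.inner_def, hun _ _ ht, hvn _ _ ht]
  have h2 : (u - v).1.2 = u.1.2 - v.1.2 := rfl
  rw [← sub_eq_zero, ← inner_sub_left, ← h2, inner_self_eq_zero] at h1
  exact h1

lemma shiftCoeffs_eq (η₀ d : ℝ) (a : Index → ℝ) : shiftCoeffs η₀ d a
    = fun i => a i + if i.m = 0 ∧ i.ν = 1 ∧ i.μ = 1 then
      neumannFactor i.n * (Real.sqrt 2 / Real.pi) * q η₀ i.n 0 * (d / area η₀) else 0 := by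
  ext i
  unfold shiftCoeffs
  split_ifs
  · ring
  · ring

end Toroidal


open Toroidal in
theorem mainTheorem8 (η₀ : ℝ) (hη₀ : 0 < η₀)
    (h : Toroidal.HMinusHalf η₀) (f : Toroidal.HHalf η₀)
    (hf : Toroidal.DirichletToNeumann f h) (c : ℝ) :
    (∃ a : Toroidal.Index → ℝ, Toroidal.HasExpansion f a) ∧
    ∀ a : Toroidal.Index → ℝ, Toroidal.HasExpansion f a →
      ∃ fhat : Toroidal.HHalf η₀,
        Toroidal.HasExpansion fhat
          (Toroidal.shiftCoeffs η₀ (c - Toroidal.bdryIntegral f) a) ∧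
        Toroidal.DirichletToNeumann fhat h ∧
        Toroidal.bdryIntegral fhat = c ∧
        ∀ g : Toroidal.HHalf η₀, Toroidal.DirichletToNeumann g h →
          Toroidal.bdryIntegral g = c → g = fhat := by
  refine ⟨⟨_, hasExpansion_fourier hη₀ f⟩, fun a ha => ?_⟩
  have hα := area_pos hη₀
  obtain ⟨e, he, hec⟩ := exists_isTrace_constH1 hη₀ ((c - bdryIntegral f) / area η₀)
  have hc : bdryIntegral (f + e) = c := by
    rw [bdryIntegral_add hη₀, bdryIntegral_of_ae_eq_const hec, mul_div_cancel₀ _ hα.ne']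
    ring
  have hΛ : DirichletToNeumann (f + e) h := hf.add_const hη₀ he
  refine ⟨f + e, ?_, hΛ, hc, fun g hg hgc => ?_⟩
  · rw [shiftCoeffs_eq]
    exact ha.add (hasExpansion_const hη₀ hec)
  · obtain ⟨k, hk⟩ := hg.exists_sub_ae_eq_const hη₀ hΛ
    have h0 : bdryIntegral (g - (f + e)) = 0 := by
      have := bdryIntegral_add hη₀ (g - (f + e)) (f + e)
      rw [sub_add_cancel, hgc, hc] at this
      linarith
    rw [bdryIntegral_of_ae_eq_const hk] at h0
    have hk0 : k = 0 := (mul_eq_zero.1 h0).resolve_left hα.ne'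
    rw [hk0] at hk
    have hz : ((g - (f + e) : HHalf η₀) : L2Bdry η₀) = 0 := (Lp.eq_zero_iff_ae_eq_zero).2 hk
    exact sub_eq_zero.1 (Subtype.ext hz)
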